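/- Let $r\ge 1$ and let $m_1,n_1,\dots,m_r,n_r$ be positive integers. Let $X=X(m_1,n_1,\dots,m_r,n_r)$ be the linear $2$-stratifold whose graph is the path $w_0 - b_1 - w_1 - \dots - b_r - w_r$, in which all white vertices $w_j$ have genus $0$ and the edge joining $b_i$ to $w_{i-1}$ (respectively $w_i$) has label $m_i$ (respectively $n_i$). Explicitly: for $1\le i\le r$ let $N_i$ be the mapping cylinder of the covering $S^1\sqcup S^1\to S^1$ given by $z\mapsto z^{m_i}$ on the first circle and $z\mapsto z^{n_i}$ on the second; let $W_0$ and $W_r$ be closed disks and $W_1,\dots,W_{r-1}$ annuli $S^1\times[0,1]$; then $X$ is obtained from the disjoint union of the $N_i$ and the $W_j$ by gluing, by arbitrary homeomorphisms, the first boundary circle of $N_i$ to a boundary circle of $W_{i-1}$ and the second boundary circle of $N_i$ to a boundary circle of $W_i$, for $i=1,\dots,r$, so that each boundary circle of each $W_j$ is used exactly once. (For every point of the central circles to have at least three sheets one needs $m_i+n_i\ge 3$; this is not needed for what follows.) Then the following are equivalent: 1. $X$ is simply connected; 2. $H_1(X;\mathbb{Z})=0$; 3. $\gcd(m_i,n_j)=1$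 for all $1\le i\le j\le r$. -/

import Mathlib

/-!
The linear 2-stratifold with black vertices `b_0, …, b_s` (so `r = s + 1` of them), white vertices
`w_0, …, w_r` of genus `0`, and edge labels `m i` (from `b_i` to the white vertex on its left) and
`n i` (from `b_i` to the white vertex on its right).

It is the union of
* the neighbourhoods `N(C_i)`, each being the mapping cylinder of the covering `S¹ ⊔ S¹ → S¹`
  that is `z ↦ z ^ m i` on one component and `z ↦ z ^ n i` on the other one;
* the surfaces of genus `0`: a disk for each of the two terminal white vertices (one boundary
  circle), an annulus for each of the other `s` white vertices (two boundary circles),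

glued along their boundary circles, as the graph prescribes, by arbitrary homeomorphisms.
-/

noncomputable section

namespace LinearStratifold

/-- The disjoint union of the pieces: the circles `C_i`; the cylinders `S¹ × [0,1]` on the left
(`false`) and on the right (`true`) of each `C_i`; the two disks; the `s` annuli. -/
abbrev Pieces (s : ℕ) : Type :=
  (Fin (s + 1) × Circle) ⊕ (Bool × Fin (s + 1) × Circle × unitInterval) ⊕
    (Bool × Metric.closedBall (0 : ℂ) 1) ⊕ (Fin s × Circle × unitInterval)

variable {s : ℕ}

/-- A point of the circle `C_i`. -/
def core (i : Fin (s + 1)) (z : Circle) : Pieces s := Sum.inl (i, z)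

/-- A point of the cylinder over the left covering circle of `C_i`. -/
def sheetL (i : Fin (s + 1)) (z : Circle) (t : unitInterval) : Pieces s :=
  Sum.inr (Sum.inl (false, i, z, t))

/-- A point of the cylinder over the right covering circle of `C_i`. -/
def sheetR (i : Fin (s + 1)) (z : Circle) (t : unitInterval) : Pieces s :=
  Sum.inr (Sum.inl (true, i, z, t))

/-- A point of the disk that is the first white vertex. -/
def firstDisk (x : Metric.closedBall (0 : ℂ) 1) : Pieces s := Sum.inr (Sum.inr (Sum.inl (false, x)))

/-- A point of the disk that is the last white vertex. -/
def lastDisk (x : Metric.closedBall (0 : ℂ) 1) : Pieces s := Sum.inr (Sum.inr (Sum.inl (true, x)))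

/-- A point of the annulus that is the white vertex between `b_k` and `b_{k+1}`. -/
def annulus (k : Fin s) (z : Circle) (t : unitInterval) : Pieces s :=
  Sum.inr (Sum.inr (Sum.inr (k, z, t)))

/-- The inclusion of the boundary circle into the closed unit disk. -/
def boundary (z : Circle) : Metric.closedBall (0 : ℂ) 1 := ⟨(z : ℂ), by simp [Circle.norm_coe]⟩

/-- The identifications. The end `t = 0` of a sheet goes to `C_i` by the covering, and the end
`t = 1` goes to a boundary circle of the adjacent white piece by a homeomorphism: `φ i` on the
left of `C_i`, `ψ i` on the right of `C_i`. -/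
inductive Glue (m n : Fin (s + 1) → ℕ) (φ ψ : Fin (s + 1) → Circle ≃ₜ Circle) :
    Pieces s → Pieces s → Prop
  | coverL (i : Fin (s + 1)) (z : Circle) : Glue m n φ ψ (sheetL i z 0) (core i (z ^ m i))
  | coverR (i : Fin (s + 1)) (z : Circle) : Glue m n φ ψ (sheetR i z 0) (core i (z ^ n i))
  | first (z : Circle) : Glue m n φ ψ (sheetL 0 z 1) (firstDisk (boundary (φ 0 z)))
  | last (z : Circle) :
      Glue m n φ ψ (sheetR (Fin.last s) z 1) (lastDisk (boundary (ψ (Fin.last s) z)))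
  | annulusL (k : Fin s) (z : Circle) :
      Glue m n φ ψ (sheetR k.castSucc z 1) (annulus k (ψ k.castSucc z) 0)
  | annulusR (k : Fin s) (z : Circle) :
      Glue m n φ ψ (sheetL k.succ z 1) (annulus k (φ k.succ z) 1)

end LinearStratifold

/-- The linear 2-stratifold `X(m_1, n_1, …, m_r, n_r)`, `r = s + 1`, with the quotient topology,
built with the gluing homeomorphisms `φ` and `ψ`. -/
def LinearStratifold {s : ℕ} (m n : Fin (s + 1) → ℕ) (φ ψ : Fin (s + 1) → Circle ≃ₜ Circle) :
    Type :=
  Quot (LinearStratifold.Glue m n φ ψ)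

instance LinearStratifold.instTopologicalSpace {s : ℕ} (m n : Fin (s + 1) → ℕ) (φ ψ : Fin (s + 1) → Circle ≃ₜ Circle) :
    TopologicalSpace (LinearStratifold m n φ ψ) :=
  inferInstanceAs (TopologicalSpace (Quot (LinearStratifold.Glue m n φ ψ)))

/-- First singular homology with integer coefficients. -/
abbrev H1 (X : Type) [TopologicalSpace X] : ModuleCat.{0} ℤ :=
  ((AlgebraicTopology.singularHomologyFunctor (ModuleCat.{0} ℤ) 1).obj (ModuleCat.of ℤ ℤ)).obj
    (TopCat.of X)

end

/-! 1 → 2: with a path `γ x` from a base point to each `x`, simple connectedness fills the triangle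
with sides `γ (σ 0)`, `σ`, `γ (σ 1)` for every singular edge `σ`. These triangles contract the
singular complex in degree one (`isZero_H1_of_simplyConnectedSpace`).

2 → 3, by contraposition: let a prime `p` divide `m i` and `n j` with `i ≤ j`, where `i` is maximal,
so that `p` divides no `m k` with `i < k ≤ j`. Let `L` be the quotient of `ℂ² \ 0` by the `p`-th
roots of unity, and `w` the loop whose `p`-fold traverse is the image of the circle `(z, 0)`. Send
`C_k` to `L` by `w (z ^ a k)` for `i ≤ k ≤ j` and to a point otherwise. This extends over the annuli
inside the range if `m (k+1) * a (k+1) = ± n k * a k`, which is solvable with `a i` prime to `p`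
(`exists_weights`). At the two ends of the range the boundary loops wind a multiple of `p` times,
hence lift to `ℂ² \ 0` and are null-homotopic. The loop `C_i` then has an image with non-closed
lifts, whereas a covering with abelian group gives a 1-cocycle that vanishes on closed edges when
`H1` does (`lift_closed_of_isZero_H1`).

3 → 1: `C_0` to the power `m 0` bounds a disk, and along each annulus the `m (k+1)`-th power of
`C_{k+1}` is freely homotopic to the `± n k`-th power of `C_k`. So `m 0 ⋯ m i` kills `C_i` and, from
the other end, so does `n i ⋯ n s`; these are coprime, and `C_i` is null-homotopic
(`killsPow_coreMap`). Cut by a height function, the space is a chain of open slabs, each deforming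
to a circle, an annulus or a disk that is trivial on fundamental groups, with path connected
overlaps. A weak van Kampen theorem (`IsThin.union`) assembles them. -/

section

open CategoryTheory Limits Simplicial

/-! ### First homology of a simplicial set: cocycles and cones. -/

namespace SSet

variable (S : SSet.{0})

theorem ιChainComplex_d_one {R : ModuleCat.{0} ℤ} (x : S _⦋1⦌) :
    S.ιChainComplex x ≫ (S.chainComplex R).d 1 0 =
      S.ιChainComplex (S.δ 0 x) - S.ιChainComplex (S.δ 1 x) := by
  rw [SSet.ιChainComplex_d]
  refine (Fin.sum_univ_two _).trans ?_
  simp [sub_eq_add_neg]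

theorem ιChainComplex_d_two {R : ModuleCat.{0} ℤ} (x : S _⦋2⦌) :
    S.ιChainComplex x ≫ (S.chainComplex R).d 2 1 =
      S.ιChainComplex (S.δ 0 x) - S.ιChainComplex (S.δ 1 x) + S.ιChainComplex (S.δ 2 x) := by
  rw [SSet.ιChainComplex_d]
  refine (Fin.sum_univ_three _).trans ?_
  simp [sub_eq_add_neg]

/-- A `1`-cocycle on a simplicial set without first homology vanishes on every closed edge. -/
theorem cocycle_eq_zero_of_isZero_homology_one
    (hS : IsZero (S.homology (ModuleCat.of ℤ ℤ) 1)) {A : Type} [AddCommGroup A]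
    (c : S _⦋1⦌ → A) (hc : ∀ τ : S _⦋2⦌, c (S.δ 0 τ) - c (S.δ 1 τ) + c (S.δ 2 τ) = 0)
    (σ : S _⦋1⦌) (hσ : S.δ 0 σ = S.δ 1 σ) : c σ = 0 := by
  have hex := (HomologicalComplex.exactAt_iff_isZero_homology _ _).2 hS
  rw [HomologicalComplex.exactAt_iff' _ 2 1 0 (by simp) (by simp),
    ShortComplex.moduleCat_exact_iff] at hex
  let R : ModuleCat.{0} ℤ := ModuleCat.of ℤ ℤ
  -- The linear extension of `c`; the cocycle condition says that it kills boundaries, and a closed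
  -- edge is a cycle, hence a boundary.
  let F : (S.chainComplex R).X 1 ⟶ ModuleCat.of ℤ A :=
    Cofan.IsColimit.desc (S.isColimitChainComplexXCofan R 1)
      fun x ↦ ModuleCat.ofHom (LinearMap.toSpanSingleton ℤ A (c x))
  have hF (x : S _⦋1⦌) : S.ιChainComplex (R := R) x ≫ F =
      ModuleCat.ofHom (LinearMap.toSpanSingleton ℤ A (c x)) :=
    Cofan.IsColimit.fac (S.isColimitChainComplexXCofan R 1) _ x
  have hdF : (S.chainComplex R).d 2 1 ≫ F = 0 := by
    refine SSet.chainComplex_hom_ext fun τ ↦ ?_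
    rw [← Category.assoc, ιChainComplex_d_two, Preadditive.add_comp, Preadditive.sub_comp, hF, hF,
      hF, comp_zero]
    ext
    simpa using hc τ
  obtain ⟨y, hy⟩ := hex ((S.ιChainComplex (R := R) σ).hom (1 : ℤ)) (by
    change (S.ιChainComplex (R := R) σ ≫ (S.chainComplex R).d 1 0).hom (1 : ℤ) = 0
    rw [ιChainComplex_d_one, hσ, sub_self]
    rfl)
  have h1 : (S.ιChainComplex (R := R) σ ≫ F).hom (1 : ℤ) = c σ := by
    rw [hF]
    exact one_smul ℤ (c σ)
  rw [← h1, ModuleCat.comp_apply, ← hy]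
  change ((S.chainComplex R).d 2 1 ≫ F).hom y = 0
  rw [hdF]; rfl

/-- The first homology vanishes if every edge is the face opposite to the cone point of a triangle
whose other two faces depend only on the end points of the edge. -/
theorem isZero_homology_one_of_cone (P : S _⦋0⦌ → S _⦋1⦌) (Q : S _⦋1⦌ → S _⦋2⦌)
    (h₀ : ∀ σ, S.δ 0 (Q σ) = σ) (h₁ : ∀ σ, S.δ 1 (Q σ) = P (S.δ 0 σ))
    (h₂ : ∀ σ, S.δ 2 (Q σ) = P (S.δ 1 σ)) :
    IsZero (S.homology (ModuleCat.of ℤ ℤ) 1) := by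
  let R : ModuleCat.{0} ℤ := ModuleCat.of ℤ ℤ
  refine (HomologicalComplex.exactAt_iff_isZero_homology _ _).1 ?_
  rw [HomologicalComplex.exactAt_iff' _ 2 1 0 (by simp) (by simp),
    ShortComplex.moduleCat_exact_iff]
  let F : (S.chainComplex R).X 1 ⟶ (S.chainComplex R).X 2 :=
    Cofan.IsColimit.desc (S.isColimitChainComplexXCofan R 1) fun x ↦ S.ιChainComplex (Q x)
  let G : (S.chainComplex R).X 0 ⟶ (S.chainComplex R).X 1 :=
    Cofan.IsColimit.desc (S.isColimitChainComplexXCofan R 0) fun x ↦ S.ιChainComplex (P x)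
  have hF (x : S _⦋1⦌) : S.ιChainComplex (R := R) x ≫ F = S.ιChainComplex (Q x) :=
    Cofan.IsColimit.fac (S.isColimitChainComplexXCofan R 1) _ x
  have hG (x : S _⦋0⦌) : S.ιChainComplex (R := R) x ≫ G = S.ιChainComplex (P x) :=
    Cofan.IsColimit.fac (S.isColimitChainComplexXCofan R 0) _ x
  -- The contraction identity in degree one: the identity is `∂F + G∂`, so every cycle `x` is the
  -- boundary of `F x`.
  have key : F ≫ (S.chainComplex R).d 2 1 = 𝟙 _ - (S.chainComplex R).d 1 0 ≫ G := by
    refine SSet.chainComplex_hom_ext fun x ↦ ?_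
    rw [← Category.assoc, hF, ιChainComplex_d_two, Preadditive.comp_sub, ← Category.assoc,
      ιChainComplex_d_one, Preadditive.sub_comp, hG, hG, Category.comp_id, h₀, h₁, h₂]
    abel
  intro (x : (S.chainComplex R).X 1) (hx : ((S.chainComplex R).d 1 0).hom x = 0)
  refine ⟨F.hom x, ?_⟩
  change (F ≫ (S.chainComplex R).d 2 1).hom x = x
  rw [key]
  change x - G.hom (((S.chainComplex R).d 1 0).hom x) = x
  rw [hx, map_zero, sub_zero]

end SSet

end

/-! ### The two criteria for singular simplices. -/

section

open CategoryTheory Limits Simplicial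

namespace stdSimplex

/-- The inclusion of the `i`-th face of a standard simplex. -/
noncomputable def face {n : ℕ} (i : Fin (n + 2)) :
    C(stdSimplex ℝ (Fin (n + 1)), stdSimplex ℝ (Fin (n + 2))) :=
  ⟨stdSimplex.map i.succAbove, stdSimplex.continuous_map _⟩

theorem face_vertex {n : ℕ} (i : Fin (n + 2)) (j : Fin (n + 1)) :
    face i (vertex j) = vertex (i.succAbove j) :=
  map_vertex _ _

theorem face_apply_succAbove {n : ℕ} (i : Fin (n + 2)) (x : stdSimplex ℝ (Fin (n + 1)))
    (j : Fin (n + 1)) : face i x (i.succAbove j) = x j := by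
  change FunOnFinite.linearMap ℝ ℝ i.succAbove x (i.succAbove j) = x j
  simp [FunOnFinite.linearMap_apply_apply, Finset.filter_eq']

theorem face_apply_self {n : ℕ} (i : Fin (n + 2)) (x : stdSimplex ℝ (Fin (n + 1))) :
    face i x i = 0 := by
  change FunOnFinite.linearMap ℝ ℝ i.succAbove x i = 0
  rw [FunOnFinite.linearMap_apply_apply]
  refine Finset.sum_eq_zero fun j hj ↦ ?_
  simp at hj

end stdSimplex

open stdSimplex

theorem TopCat.toSSetObjEquiv_δ (X : TopCat.{0}) {n : ℕ} (i : Fin (n + 2))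
    (τ : (TopCat.toSSet.obj X) _⦋n + 1⦌) :
    X.toSSetObjEquiv _ ((TopCat.toSSet.obj X).δ i τ) = (X.toSSetObjEquiv _ τ).comp (face i) :=
  rfl

/-- A singular `1`-cocycle on a space without first homology vanishes on every closed edge. -/
theorem singular_cocycle_eq_zero {X : Type} [TopologicalSpace X] (hX : IsZero (H1 X))
    {A : Type} [AddCommGroup A] (c : C(stdSimplex ℝ (Fin 2), X) → A)
    (hc : ∀ τ : C(stdSimplex ℝ (Fin 3), X),
      c (τ.comp (face 0)) - c (τ.comp (face 1)) + c (τ.comp (face 2)) = 0)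
    (σ : C(stdSimplex ℝ (Fin 2), X)) (hσ : σ (vertex 0) = σ (vertex 1)) : c σ = 0 := by
  let e (n : ℕ) := (TopCat.of X).toSSetObjEquiv (.op ⦋n⦌)
  have h := SSet.cocycle_eq_zero_of_isZero_homology_one (TopCat.toSSet.obj (TopCat.of X)) hX
    (fun s ↦ c (e 1 s)) (fun τ ↦ hc (e 2 τ)) ((e 1).symm σ) ((e 0).injective ?_)
  · simpa using h
  · refine (TopCat.toSSetObjEquiv_δ _ _ _).trans (Eq.trans ?_ (TopCat.toSSetObjEquiv_δ _ _ _).symm)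
    have : (TopCat.of X).toSSetObjEquiv (.op ⦋0 + 1⦌) ((e 1).symm σ) = σ := (e 1).apply_symm_apply σ
    rw [this]
    ext x
    obtain rfl : x = vertex 0 := by subsingleton
    change σ (face 0 (vertex 0)) = σ (face 1 (vertex 0))
    rw [face_vertex, face_vertex]
    exact hσ.symm

/-- Vanishing of the first homology from a choice of a cone over every singular edge. -/
theorem isZero_H1_of_cone {X : Type} [TopologicalSpace X] (P : X → C(stdSimplex ℝ (Fin 2), X))
    (h : ∀ σ : C(stdSimplex ℝ (Fin 2), X), ∃ τ : C(stdSimplex ℝ (Fin 3), X),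
      τ.comp (face 0) = σ ∧ τ.comp (face 1) = P (σ (vertex 1)) ∧
        τ.comp (face 2) = P (σ (vertex 0))) : IsZero (H1 X) := by
  choose Q h₀ h₁ h₂ using h
  let e (n : ℕ) := (TopCat.of X).toSSetObjEquiv (.op ⦋n⦌)
  refine SSet.isZero_homology_one_of_cone (TopCat.toSSet.obj (TopCat.of X))
    (fun x ↦ (e 1).symm (P (e 0 x (vertex 0)))) (fun σ ↦ (e 2).symm (Q (e 1 σ)))
    (fun σ ↦ (e 1).injective ?_) (fun σ ↦ (e 1).injective ?_) (fun σ ↦ (e 1).injective ?_)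
  all_goals
    refine (TopCat.toSSetObjEquiv_δ _ _ _).trans ?_
    have : (TopCat.of X).toSSetObjEquiv (.op ⦋1 + 1⦌) ((e 2).symm (Q (e 1 σ))) = Q (e 1 σ) :=
      (e 2).apply_symm_apply _
    rw [this]
  · exact h₀ _
  · rw [Equiv.apply_symm_apply]
    refine (h₁ _).trans (congrArg P ?_)
    change _ = (e 1 σ) (face 0 (vertex 0))
    rw [face_vertex]; rfl
  · rw [Equiv.apply_symm_apply]
    refine (h₂ _).trans (congrArg P ?_)
    change _ = (e 1 σ) (face 1 (vertex 0))
    rw [face_vertex]; rfl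

end

/-! ### Simply connected spaces have no first homology. -/

section

open CategoryTheory Limits unitInterval stdSimplex

namespace stdSimplex

/-- The height of the roof over the unit interval with top at `1 / 2`. -/
def roof (s : ℝ) : ℝ := min (2 * s) (2 - 2 * s)

/-- The map of the square onto the triangle that collapses the sides `s = 0` and `s = 1` to
vertices, takes the side `t = 1` to an edge and the side `t = 0` to the other two edges. -/
noncomputable def squareToTriangle : C(I × I, stdSimplex ℝ (Fin 3)) where
  toFun x := ⟨![1 - x.2 - (1 - x.1) * roof x.2 / 2, (1 - x.1) * roof x.2,
      x.2 - (1 - x.1) * roof x.2 / 2], by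
    obtain ⟨⟨t, ht₀, ht₁⟩, ⟨s, hs₀, hs₁⟩⟩ := x
    have h₀ : 0 ≤ roof s := le_min (by linarith) (by linarith)
    have h₁ : roof s ≤ 2 * s := min_le_left _ _
    have h₂ : roof s ≤ 2 - 2 * s := min_le_right _ _
    refine ⟨fun i ↦ ?_, ?_⟩
    · fin_cases i <;> simp <;> nlinarith
    · simp [Fin.sum_univ_three]; ring⟩
  continuous_toFun := by
    refine Continuous.subtype_mk (continuous_pi fun i ↦ ?_) _
    have : Continuous roof := by unfold roof; fun_prop
    fin_cases i <;> simp <;> fun_prop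

theorem squareToTriangle_one (x : I × I) : squareToTriangle x 1 = (1 - x.1) * roof x.2 := rfl

theorem squareToTriangle_two (x : I × I) :
    squareToTriangle x 2 = x.2 - (1 - x.1) * roof x.2 / 2 := rfl

theorem ext_triangle {x y : stdSimplex ℝ (Fin 3)} (h₁ : x 1 = y 1) (h₂ : x 2 = y 2) : x = y := by
  have hx := sum_eq_one x
  have hy := sum_eq_one y
  rw [Fin.sum_univ_three] at hx hy
  ext i
  fin_cases i
  · change x 0 = y 0; linarith
  · exact h₁
  · exact h₂

/-- The coordinates force `s = x 2 + x 1 / 2` and `1 - t = x 1 / roof s`. If `roof s = 0` then `x 1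
= 0` too, and any `t` will do. -/
theorem squareToTriangle_surjective : Function.Surjective squareToTriangle := by
  intro x
  have hx := sum_eq_one x
  rw [Fin.sum_univ_three] at hx
  have h0 := zero_le x 0
  have h1 := zero_le x 1
  have h2 := zero_le x 2
  have hroof : x 1 ≤ roof (x 2 + x 1 / 2) := le_min (by linarith) (by linarith)
  have hs : x 2 + x 1 / 2 ∈ I := ⟨by linarith, by linarith⟩
  rcases (h1.trans hroof).eq_or_lt with h | h
  · refine ⟨(0, ⟨_, hs⟩), ext_triangle ?_ ?_⟩
    · rw [squareToTriangle_one]; simp; linarith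
    · rw [squareToTriangle_two]; simp; linarith
  · refine ⟨(⟨1 - x 1 / roof (x 2 + x 1 / 2), ?_, ?_⟩, ⟨_, hs⟩), ext_triangle ?_ ?_⟩
    · rw [sub_nonneg, div_le_one h]; exact hroof
    · have := div_nonneg h1 h.le; linarith
    · rw [squareToTriangle_one]; simp only [sub_sub_cancel]; exact div_mul_cancel₀ _ h.ne'
    · rw [squareToTriangle_two]; simp only [sub_sub_cancel]; rw [div_mul_cancel₀ _ h.ne']; ring

/-- `s` can be read off from the image, and then `t` as well unless `roof s = 0`, that is on the two
collapsed sides. -/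
theorem squareToTriangle_eq {x y : I × I} (h : squareToTriangle x = squareToTriangle y) :
    x = y ∨ (x.2 = 0 ∧ y.2 = 0) ∨ (x.2 = 1 ∧ y.2 = 1) := by
  have h1 : squareToTriangle x 1 = squareToTriangle y 1 := by rw [h]
  have h2 : squareToTriangle x 2 = squareToTriangle y 2 := by rw [h]
  rw [squareToTriangle_one, squareToTriangle_one] at h1
  rw [squareToTriangle_two, squareToTriangle_two, h1] at h2
  have hs : x.2 = y.2 := Subtype.ext (by linarith)
  rw [hs] at h1
  rcases mul_eq_mul_right_iff.1 h1 with h3 | h3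
  · exact Or.inl (Prod.ext (Subtype.ext (by linarith)) hs)
  · rcases min_choice (2 * (y.2 : ℝ)) (2 - 2 * y.2) with h4 | h4 <;>
      rw [roof, h4] at h3
    · refine Or.inr (Or.inl ?_)
      rw [hs, and_self]; exact Subtype.ext (by simpa using h3)
    · refine Or.inr (Or.inr ?_)
      rw [hs, and_self]; exact Subtype.ext (by rw [Set.Icc.coe_one]; linarith)

/-- A homotopy of paths from a concatenation to a path, as a map of a triangle. -/
theorem exists_triangle_of_homotopic {X : Type*} [TopologicalSpace X] {x y z : X} {p : Path x y}
    {q : Path y z} {r : Path x z} (h : (p.trans q).Homotopic r) :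
    ∃ τ : C(stdSimplex ℝ (Fin 3), X),
      (∀ u, τ (face 2 u) = p (stdSimplexHomeomorphUnitInterval u)) ∧
      (∀ u, τ (face 0 u) = q (stdSimplexHomeomorphUnitInterval u)) ∧
      (∀ u, τ (face 1 u) = r (stdSimplexHomeomorphUnitInterval u)) := by
  obtain ⟨H⟩ := h
  -- A surjection from a compact space to a Hausdorff one is a quotient map, and `H` is constant on
  -- the collapsed sides because it fixes end points.
  have hq : Topology.IsQuotientMap squareToTriangle :=
    squareToTriangle.continuous.isClosedMap.isQuotientMap squareToTriangle.continuous
      squareToTriangle_surjective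
  have hH : Function.FactorsThrough H.toContinuousMap squareToTriangle := by
    rintro ⟨t, s⟩ ⟨t', s'⟩ h
    rcases squareToTriangle_eq h with h | h | h
    · rw [h]
    · obtain ⟨rfl, rfl⟩ : s = 0 ∧ s' = 0 := h
      exact (H.source t).trans (H.source t').symm
    · obtain ⟨rfl, rfl⟩ : s = 1 ∧ s' = 1 := h
      exact (H.target t).trans (H.target t').symm
  let τ := hq.lift H.toContinuousMap hH
  have hτ (a : I × I) : τ (squareToTriangle a) = H a :=
    DFunLike.congr_fun (hq.lift_comp H.toContinuousMap hH) a
  have key {v : stdSimplex ℝ (Fin 3)} (a : I × I) (h₁ : v 1 = (1 - a.1) * roof a.2)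
      (h₂ : v 2 = a.2 - v 1 / 2) : τ v = H a := by
    rw [← hτ]
    congr 1
    refine ext_triangle (h₁.trans (squareToTriangle_one a).symm) ?_
    rw [squareToTriangle_two, ← h₁, h₂]
  have h21 (u : stdSimplex ℝ (Fin 2)) : face 2 u 1 = u 1 := by
    simpa using! face_apply_succAbove (n := 1) 2 u 1
  have h22 (u : stdSimplex ℝ (Fin 2)) : face 2 u 2 = 0 := face_apply_self (n := 1) 2 u
  have h01 (u : stdSimplex ℝ (Fin 2)) : face 0 u 1 = u 0 := by
    simpa using! face_apply_succAbove (n := 1) 0 u 0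
  have h02 (u : stdSimplex ℝ (Fin 2)) : face 0 u 2 = u 1 := by
    simpa using! face_apply_succAbove (n := 1) 0 u 1
  have h11 (u : stdSimplex ℝ (Fin 2)) : face 1 u 1 = 0 := face_apply_self (n := 1) 1 u
  have h12 (u : stdSimplex ℝ (Fin 2)) : face 1 u 2 = u 1 := by
    simpa using! face_apply_succAbove (n := 1) 1 u 1
  refine ⟨τ, fun u ↦ ?_, fun u ↦ ?_, fun u ↦ ?_⟩
  · have hu0 := zero_le u 1
    have hu1 := le_one u 1
    -- The side `t = 0` carries the concatenation: `p` runs over the parameters `u 1 / 2`, and `q`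
    -- over `(1 + u 1) / 2`.
    rw [key (0, ⟨u 1 / 2, by linarith, by linarith⟩), H.apply_zero, Path.coe_toContinuousMap,
      Path.trans_apply, dif_pos (by change u 1 / 2 ≤ 1 / 2; linarith)]
    · congr 1
      ext
      exact mul_div_cancel₀ _ two_ne_zero
    · rw [h21, roof, min_eq_left (by simp; linarith)]; simp; ring
    · rw [h21, h22]; simp
  · have hu := add_eq_one u
    have hu0 := zero_le u 1
    have hu1 := le_one u 1
    rw [key (0, ⟨(1 + u 1) / 2, by linarith, by linarith⟩), H.apply_zero, Path.coe_toContinuousMap,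
      Path.trans_apply]
    · split_ifs with h
      -- Only the junction of `p` and `q` falls into this branch.
      · have h' : u 1 = 0 := by simp at h; linarith
        have e1 : stdSimplexHomeomorphUnitInterval u = 0 := Subtype.ext h'
        rw [e1, q.source]
        convert p.target
        simp [h']
      · congr 1
        ext
        simp; rw [show u.1 1 = u 1 from rfl]; ring
    · rw [h01, roof, min_eq_right (by simp; linarith)]; simp; linarith
    · rw [h01, h02]; simp; linarith
  · rw [key (1, stdSimplexHomeomorphUnitInterval u), H.apply_one, Path.coe_toContinuousMap]
    · rw [h11]; simp
    · rw [h11, h12]; simp; rfl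

end stdSimplex

/-- The first homology of a simply connected space vanishes. -/
theorem isZero_H1_of_simplyConnectedSpace (X : Type) [TopologicalSpace X]
    [SimplyConnectedSpace X] : IsZero (H1 X) := by
  obtain ⟨x₀⟩ : Nonempty X := PathConnectedSpace.nonempty
  let γ (x : X) : Path x₀ x := PathConnectedSpace.somePath x₀ x
  let e := stdSimplexHomeomorphUnitInterval
  have he0 : e.symm 0 = vertex 0 := e.symm_apply_eq.2 rfl
  have he1 : e.symm 1 = vertex 1 := e.symm_apply_eq.2 rfl
  refine isZero_H1_of_cone (fun x ↦ (γ x).toContinuousMap.comp ⟨e, e.continuous⟩) fun c ↦ ?_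
  let q : Path (c (vertex 0)) (c (vertex 1)) :=
    { toFun := fun t ↦ c (e.symm t)
      continuous_toFun := by fun_prop
      source' := by rw [he0]
      target' := by rw [he1] }
  obtain ⟨τ, h₂, h₀, h₁⟩ := exists_triangle_of_homotopic
    (SimplyConnectedSpace.paths_homotopic ((γ (c (vertex 0))).trans q) (γ (c (vertex 1))))
  refine ⟨τ, ?_, ?_, ?_⟩
  · ext u
    refine (h₀ u).trans ?_
    change c (e.symm (e u)) = c u
    rw [e.symm_apply_apply]
  · ext u; exact h₁ u
  · ext u; exact h₂ u

end

/-! ### Coverings with abelian group over spaces without first homology. -/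

section

open CategoryTheory Limits stdSimplex

instance stdSimplex.contractibleSpace_real (n : ℕ) :
    ContractibleSpace (stdSimplex ℝ (Fin (n + 1))) :=
  (convex_stdSimplex ℝ (Fin (n + 1))).contractibleSpace ⟨_, single_mem_stdSimplex ℝ 0⟩

instance stdSimplex.locallyPathConnectedSpace_real (n : ℕ) :
    LocallyPathConnectedSpace (stdSimplex ℝ (Fin (n + 1))) :=
  (convex_stdSimplex ℝ (Fin (n + 1))).locallyPathConnectedSpace

section

variable {E Y G : Type} [TopologicalSpace E] [TopologicalSpace Y] [CommGroup G] [MulAction G E]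
  {q : E → Y}

/-- If the first homology of `X` vanishes, a closed edge in `X` that is mapped to the base of a
regular covering with abelian group lifts to closed edges only. -/
theorem IsQuotientCoveringMap.lift_closed_of_isZero_H1 (hq : IsQuotientCoveringMap q G)
    {X : Type} [TopologicalSpace X] (hX : IsZero (H1 X)) (g : C(X, Y))
    (σ : C(stdSimplex ℝ (Fin 2), X)) (hσ : σ (vertex 0) = σ (vertex 1))
    (σ' : C(stdSimplex ℝ (Fin 2), E)) (hσ' : ∀ u, q (σ' u) = g (σ u)) :
    σ' (vertex 0) = σ' (vertex 1) := by
  have hcov := hq.isCoveringMap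
  have hcancel := hq.isCancelSMul
  have hcont := hq.toContinuousConstSMul
  -- A set-theoretic section, not continuous: `dev e` is the group element that carries its value at
  -- `q e` to `e`.
  choose s hs using hq.surjective
  have hdev (e : E) : ∃ a : G, a • s (q e) = e := by
    have : q e = q (s (q e)) := (hs _).symm
    exact hq.apply_eq_iff_mem_orbit.1 this
  choose dev hdev using hdev
  have dev_smul (a : G) (e : E) : dev (a • e) = a * dev e := by
    have h := hdev (a • e)
    rw [hq.map_smul] at h
    refine IsCancelSMul.right_cancel _ _ (s (q e)) ?_
    rw [h, mul_smul, hdev]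
  have exists_lift {n : ℕ} (τ : C(stdSimplex ℝ (Fin (n + 1)), X)) :
      ∃ τ' : C(stdSimplex ℝ (Fin (n + 1)), E), ∀ u, q (τ' u) = g (τ u) := by
    obtain ⟨τ', ⟨-, h⟩, -⟩ := hcov.existsUnique_continuousMap_lifts (g.comp τ) (vertex 0)
      (s (g (τ (vertex 0)))) (hs _)
    exact ⟨τ', fun u ↦ congrFun h u⟩
  -- The change of `dev` along a lifted edge. Another lift is a translate, which multiplies both
  -- terms by the same element; as `G` is commutative, this cancels.
  let val (ρ : C(stdSimplex ℝ (Fin 2), E)) : G := dev (ρ (vertex 1)) / dev (ρ (vertex 0))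
  have val_eq (ρ ρ' : C(stdSimplex ℝ (Fin 2), E)) (h : ∀ u, q (ρ u) = q (ρ' u)) :
      val ρ = val ρ' := by
    obtain ⟨a, ha⟩ : ρ (vertex 0) ∈ MulAction.orbit G (ρ' (vertex 0)) :=
      hq.apply_eq_iff_mem_orbit.1 (h _)
    have : (ρ : stdSimplex ℝ (Fin 2) → E) = fun u ↦ a • ρ' u := by
      refine hcov.eq_of_comp_eq ρ.continuous (by fun_prop) ?_ (vertex 0) ha.symm
      ext u
      simp [hq.map_smul, h]
    simp only [val, this, dev_smul]
    exact mul_div_mul_left_eq_div _ _ _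
  choose lift hlift using fun τ : C(stdSimplex ℝ (Fin 2), X) ↦ exists_lift τ
  -- On one lift of the whole triangle the three quotients telescope, so `val` is a cocycle.
  have h := singular_cocycle_eq_zero hX (fun ρ ↦ Additive.ofMul (val (lift ρ))) (fun τ ↦ by
    obtain ⟨τ', hτ'⟩ := exists_lift τ
    have e (i : Fin 3) : val (lift (τ.comp (face i))) = val (τ'.comp (face i)) :=
      val_eq _ _ fun u ↦ (hlift _ u).trans (hτ' _).symm
    simp only [e]
    rw [← ofMul_div, ← ofMul_mul, ← ofMul_one]
    congr 1
    simp only [val, ContinuousMap.comp_apply, face_vertex]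
    simp [Fin.succAbove]
    ) σ hσ
  have h1 : val σ' = 1 := by
    rw [← val_eq (lift σ) σ' fun u ↦ (hlift σ u).trans (hσ' u).symm]
    exact h
  rw [← hdev (σ' (vertex 0)), ← hdev (σ' (vertex 1)), hσ', hσ', hσ, div_eq_one.1 h1]

end

end

/-! ### Degrees of self-maps of the circle. -/

section

open unitInterval

namespace Circle

/-- The `d`-th power map of the circle. -/
noncomputable def zpowMap (d : ℤ) : C(Circle, Circle) := ⟨fun z ↦ z ^ d, continuous_zpow d⟩

/-- Self-maps of the circle lift to the universal covering. -/
theorem exists_real_lift (f : C(Circle, Circle)) :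
    ∃ (d : ℤ) (F : C(ℝ, ℝ)), (∀ x, exp (F x) = f (exp x)) ∧
      ∀ x, F (x + 2 * Real.pi) = F x + d * (2 * Real.pi) := by
  obtain ⟨x₀, hx₀⟩ := Circle.exp_surjective (f (exp 0))
  obtain ⟨F, ⟨-, hF⟩, -⟩ := isCoveringMap_exp.existsUnique_continuousMap_lifts
    (f.comp exp) 0 x₀ hx₀
  replace hF (x : ℝ) : exp (F x) = f (exp x) := congrFun hF x
  have h (x : ℝ) : ∃ d : ℤ, F (x + 2 * Real.pi) = F x + d * (2 * Real.pi) :=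
    exp_eq_exp.1 (by rw [hF, hF, exp_add_two_pi])
  choose d hd using h
  have hcont : Continuous fun x ↦ (d x : ℝ) := by
    have : (fun x ↦ (d x : ℝ)) = fun x ↦ (F (x + 2 * Real.pi) - F x) / (2 * Real.pi) := by
      ext x
      rw [hd, add_sub_cancel_left, mul_div_cancel_right₀ _ (by positivity)]
    rw [this]
    fun_prop
  -- A continuous integer-valued function on the line is constant.
  have hcont' : Continuous d := Int.isClosedEmbedding_coe_real.continuous_iff.2 hcont
  refine ⟨d 0, F, hF, fun x ↦ ?_⟩
  rw [hd, PreconnectedSpace.constant inferInstance hcont' (x := x) (y := 0)]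

theorem exp_zpow (x : ℝ) (d : ℤ) : exp x ^ d = exp (d * x) := by
  have h := expHom.map_zsmul d x
  rw [zsmul_eq_mul] at h
  exact (congrArg Additive.toMul h).symm

theorem real_lift_add_int_mul {F : C(ℝ, ℝ)} {d : ℤ}
    (hd : ∀ x, F (x + 2 * Real.pi) = F x + d * (2 * Real.pi)) (x : ℝ) (k : ℤ) :
    F (x + k * (2 * Real.pi)) = F x + d * (k * (2 * Real.pi)) := by
  induction k with
  | zero => simp
  | succ k ih =>
    push_cast at ih ⊢
    rw [show x + (k + 1) * (2 * Real.pi) = x + k * (2 * Real.pi) + 2 * Real.pi by ring, hd, ih]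
    ring
  | pred k ih =>
    push_cast at ih ⊢
    have := hd (x + (-k - 1) * (2 * Real.pi))
    rw [show x + (-k - 1) * (2 * Real.pi) + 2 * Real.pi = x + -k * (2 * Real.pi) by ring, ih]
      at this
    linarith

/-- The straight-line homotopy from `F` to `x ↦ d * x` shifts by `2πdk` when `x` shifts by `2πk`, so
it descends to the circle. It is curried so that the quotient map `exp` suffices, with no product of
quotient maps. -/
theorem homotopic_zpowMap_of_real_lift {f : C(Circle, Circle)} {d : ℤ} {F : C(ℝ, ℝ)}
    (hF : ∀ x, exp (F x) = f (exp x)) (hd : ∀ x, F (x + 2 * Real.pi) = F x + d * (2 * Real.pi)) :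
    f.Homotopic (zpowMap d) := by
  have hq : Topology.IsQuotientMap exp := isCoveringMap_exp.isQuotientMap exp_surjective
  let K : C(ℝ × I, Circle) := ⟨fun x ↦ exp ((1 - x.2) * F x.1 + x.2 * (d * x.1)), by fun_prop⟩
  have hK : Function.FactorsThrough K.curry exp := by
    intro x y hxy
    obtain ⟨k, rfl⟩ := exp_eq_exp.1 hxy
    ext t
    congr 1
    refine exp_eq_exp.2 ⟨d * k, ?_⟩
    simp only [real_lift_add_int_mul hd]
    push_cast
    ring
  let L : C(Circle, C(I, Circle)) := hq.lift K.curry hK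
  have hL (x : ℝ) (t : I) : L (exp x) t = K (x, t) :=
    DFunLike.congr_fun (DFunLike.congr_fun (hq.lift_comp K.curry hK) x) t
  refine ⟨⟨L.uncurry.comp ⟨Prod.swap, continuous_swap⟩, fun z ↦ ?_, fun z ↦ ?_⟩⟩
  · obtain ⟨x, rfl⟩ := exp_surjective z
    change L (exp x) 0 = _
    rw [hL]
    simp [K, hF]
  · obtain ⟨x, rfl⟩ := exp_surjective z
    change L (exp x) 1 = exp x ^ d
    rw [hL, exp_zpow]
    simp [K]

/-- Self-homeomorphisms of the circle have degree `1` or `-1`. -/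
theorem exists_isUnit_homotopic_zpowMap (θ : Circle ≃ₜ Circle) :
    ∃ d : ℤ, IsUnit d ∧ (θ : C(Circle, Circle)).Homotopic (zpowMap d) := by
  obtain ⟨d, F, hF, hd⟩ := exists_real_lift (θ : C(Circle, Circle))
  obtain ⟨e, G, hG, he⟩ := exists_real_lift (θ.symm : C(Circle, Circle))
  refine ⟨d, ?_, homotopic_zpowMap_of_real_lift hF hd⟩
  -- Both sides lift `exp` and agree at `0`. Comparing them at `2π` shows that the product of the
  -- degrees is `1`.
  have h : G ∘ F = fun x ↦ x + G (F 0) := by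
    refine isCoveringMap_exp.eq_of_comp_eq (by fun_prop) (by fun_prop) ?_ 0 (by simp)
    ext x
    have hx (x : ℝ) : exp (G (F x)) = exp x := by
      rw [hG, hF]
      exact θ.symm_apply_apply _
    simp [exp_add, hx]
  have h1 := congrFun h (0 + 2 * Real.pi)
  simp only [Function.comp_apply] at h1
  rw [hd, real_lift_add_int_mul he, zero_add, add_comm] at h1
  have h2 := mul_right_cancel₀ (b := 2 * Real.pi) (by positivity)
    (((mul_assoc _ _ _).trans (add_right_cancel h1)).trans (one_mul _).symm)
  exact IsUnit.of_mul_eq_one e (by rw [mul_comm]; exact_mod_cast h2)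

end Circle

end

/-! ### The punctured plane and its lens quotient. -/

section

open unitInterval

/-- The punctured plane of dimension two over `ℂ`, with the action of the circle. -/
def PuncturedPlane : Type := {v : ℂ × ℂ // v ≠ 0}

namespace PuncturedPlane

instance : TopologicalSpace PuncturedPlane := inferInstanceAs (TopologicalSpace {v : ℂ × ℂ // v ≠ 0})

instance : T2Space PuncturedPlane := inferInstanceAs (T2Space {v : ℂ × ℂ // v ≠ 0})

instance : LocallyCompactSpace PuncturedPlane :=
  isOpen_ne.isOpenEmbedding_subtypeVal.locallyCompactSpace

noncomputable instance : MulAction Circle PuncturedPlane where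
  smul z v := ⟨z • v.1, fun h ↦ v.2 ((smul_eq_zero_iff_eq z).1 h)⟩
  one_smul v := Subtype.ext (one_smul _ v.1)
  mul_smul z w v := Subtype.ext (mul_smul z w v.1)

instance : ContinuousConstSMul Circle PuncturedPlane where
  continuous_const_smul z := by
    refine Continuous.subtype_mk (f := fun v : PuncturedPlane ↦ z • v.1) ?_ _
    exact continuous_subtype_val.const_smul z

instance : IsCancelSMul Circle PuncturedPlane where
  right_cancel' z w v h := by
    have h1 : z • v.1 = w • v.1 := congrArg Subtype.val h
    have h2 : ((z : ℂ) - w) • v.1 = 0 := by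
      rw [sub_smul, sub_eq_zero]; exact h1
    rcases smul_eq_zero.1 h2 with h3 | h3
    · exact Circle.ext (sub_eq_zero.1 h3)
    · exact absurd h3 v.2

/-- The point `(z, 0)`. -/
noncomputable def left : C(Circle, PuncturedPlane) where
  toFun z := ⟨((z : ℂ), 0), by simp⟩
  continuous_toFun := by
    refine Continuous.subtype_mk (f := fun z : Circle ↦ ((z : ℂ), (0 : ℂ))) ?_ _
    fun_prop

theorem left_injective : Function.Injective left := fun _ _ h ↦
  Circle.ext (congrArg (fun v : PuncturedPlane ↦ v.1.1) h)

/-- The point `(0, 1)`. -/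
def apex : PuncturedPlane := ⟨(0, 1), by simp⟩

/-- The segment from `(u z, 0)` to `(0, 1)` avoids the origin. With such explicit contractions,
simple connectedness of the punctured plane is never needed. -/
theorem left_homotopic_const (u : C(Circle, Circle)) :
    (left.comp u).Homotopic (.const _ apex) := by
  refine ⟨⟨⟨fun x ↦ ⟨(((1 - x.1 : ℝ) : ℂ) * (u x.2 : ℂ), ((x.1 : ℝ) : ℂ)), ?_⟩, ?_⟩, fun z ↦ ?_,
    fun z ↦ ?_⟩⟩
  · intro h
    obtain ⟨h1, h2⟩ := Prod.mk_eq_zero.1 h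
    rw [Complex.ofReal_eq_zero] at h2
    simp [h2] at h1
  · refine Continuous.subtype_mk (f := fun x : I × Circle ↦
      ((((1 - x.1 : ℝ) : ℂ) * (u x.2 : ℂ), ((x.1 : ℝ) : ℂ)))) ?_ _
    fun_prop
  · refine Subtype.ext ?_
    change (((1 - (0 : I) : ℝ) : ℂ) * (u z : ℂ), (((0 : I) : ℝ) : ℂ)) = ((u z : ℂ), 0)
    simp
  · refine Subtype.ext ?_
    change (((1 - (1 : I) : ℝ) : ℂ) * (u z : ℂ), (((1 : I) : ℝ) : ℂ)) = (0, 1)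
    simp

theorem isClosedEmbedding_boundary : Topology.IsClosedEmbedding LinearStratifold.boundary := by
  refine Topology.IsClosedEmbedding.of_continuous_injective_isClosedMap ?_ ?_ ?_
  · exact Continuous.subtype_mk (by fun_prop) _
  · intro z w h
    exact Circle.ext (Subtype.mk.inj h)
  · refine Continuous.isClosedMap ?_
    exact Continuous.subtype_mk (by fun_prop) _

/-- The first coordinate is a Tietze extension of `u`, which may vanish inside. The second, `1 -
‖x‖`, vanishes only on the boundary, where the first has modulus one. -/
theorem exists_disk_extension (u : C(Circle, Circle)) :
    ∃ d : C(Metric.closedBall (0 : ℂ) 1, PuncturedPlane),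
      ∀ z, d (LinearStratifold.boundary z) = left (u z) := by
  obtain ⟨U, hU⟩ := ContinuousMap.exists_extension isClosedEmbedding_boundary
    (⟨fun z ↦ (u z : ℂ), by fun_prop⟩ : C(Circle, ℂ))
  have hU' (z : Circle) : U (LinearStratifold.boundary z) = u z := DFunLike.congr_fun hU z
  refine ⟨⟨fun x ↦ ⟨(U x, ((1 - ‖(x : ℂ)‖ : ℝ) : ℂ)), ?_⟩, ?_⟩, fun z ↦ ?_⟩
  · intro h
    obtain ⟨h1, h2⟩ := Prod.mk_eq_zero.1 h
    rw [Complex.ofReal_eq_zero, sub_eq_zero] at h2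
    let z : Circle := ⟨x, by simpa [Submonoid.unitSphere] using h2.symm⟩
    have hz : LinearStratifold.boundary z = x := rfl
    rw [← hz, hU'] at h1
    exact Circle.coe_ne_zero _ h1
  · refine Continuous.subtype_mk (f := fun x : Metric.closedBall (0 : ℂ) 1 ↦
      (U x, ((1 - ‖(x : ℂ)‖ : ℝ) : ℂ))) ?_ _
    fun_prop
  · refine Subtype.ext ?_
    change (U (LinearStratifold.boundary z), ((1 - ‖(z : ℂ)‖ : ℝ) : ℂ)) = ((u z : ℂ), 0)
    simp only [hU', Circle.norm_coe, sub_self, Complex.ofReal_zero]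

end PuncturedPlane

section Lens

variable (p : ℕ)

/-- The group of `p`-th roots of unity in the circle. -/
noncomputable abbrev circleRoots : Subgroup Circle := (powMonoidHom (α := Circle) p).ker

/-- The quotient of the punctured plane by the group of `p`-th roots of unity. -/
abbrev LensSpace : Type := MulAction.orbitRel.Quotient (circleRoots p) PuncturedPlane

namespace LensSpace

instance [NeZero p] : Finite (circleRoots p) := by
  refine Finite.of_injective (β := Polynomial.nthRootsFinset p (1 : ℂ))
    (fun z ↦ ⟨((z : Circle) : ℂ), ?_⟩) fun z w h ↦ ?_
  · rw [Polynomial.mem_nthRootsFinset (NeZero.pos p), ← Circle.coe_pow,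
      show (z : Circle) ^ p = 1 from z.2, Circle.coe_one]
  · exact Subtype.ext (Circle.ext (Subtype.mk.inj h))

/-- The projection to the quotient. -/
noncomputable def proj : C(PuncturedPlane, LensSpace p) :=
  ⟨Quotient.mk _, continuous_quotient_mk'⟩

theorem isQuotientCoveringMap_proj [NeZero p] :
    IsQuotientCoveringMap (proj p) (circleRoots p) := by
  have : IsCancelSMul (circleRoots p) PuncturedPlane := ⟨fun z w v h ↦
    Subtype.ext (IsCancelSMul.right_cancel (z : Circle) w v h)⟩
  have : ContinuousConstSMul (circleRoots p) PuncturedPlane :=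
    ⟨fun z ↦ continuous_const_smul (z : Circle)⟩
  exact isQuotientCoveringMap_quotientMk_of_properlyDiscontinuousSMul

/-- Two points with the same `p`-th power differ by a root of unity, which the projection absorbs;
so `z ↦ [(z, 0)]` factors through `z ↦ z ^ p`. -/
theorem exists_loop [NeZero p] :
    ∃ j : C(Circle, LensSpace p), ∀ z, j (z ^ p) = proj p (PuncturedPlane.left z) := by
  let P : C(Circle, Circle) := ⟨fun z ↦ z ^ p, continuous_pow p⟩
  have hq := Circle.isQuotientCoveringMap_npow p
  have hP : Topology.IsQuotientMap P := hq.toIsQuotientMap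
  have hf : Function.FactorsThrough ((proj p).comp PuncturedPlane.left) P := by
    intro z w h
    obtain ⟨g, rfl⟩ := hq.apply_eq_iff_mem_orbit.1 h
    have : PuncturedPlane.left (g • w) = g • PuncturedPlane.left w := by
      refine Subtype.ext ?_
      change _ = (g : Circle) • (PuncturedPlane.left w).1
      exact Prod.ext rfl (smul_zero (g : Circle)).symm
    simp only [ContinuousMap.comp_apply]
    rw [this]
    exact (isQuotientCoveringMap_proj p).map_smul g
  exact ⟨hP.lift _ hf, fun z ↦ DFunLike.congr_fun (hP.lift_comp _ hf) z⟩

end LensSpace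

end Lens

end

/-! ### Maps out of the stratifold. -/

section

open unitInterval

namespace LinearStratifold

variable {s : ℕ} (m n : Fin (s + 1) → ℕ) (φ ψ : Fin (s + 1) → Circle ≃ₜ Circle)

/-- The closed unit disk. -/
abbrev Disk : Type := Metric.closedBall (0 : ℂ) 1

/-- The projection of the pieces to the stratifold. -/
noncomputable def mk : C(Pieces s, LinearStratifold m n φ ψ) := ⟨Quot.mk _, continuous_quot_mk⟩

/-- The inclusion of the circle `C_i`. -/
noncomputable def coreMap (i : Fin (s + 1)) : C(Circle, LinearStratifold m n φ ψ) :=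
  (mk m n φ ψ).comp ⟨core i, by unfold core; fun_prop⟩

/-- The map of the cylinder on the left of `C_i`. -/
noncomputable def sheetLMap (i : Fin (s + 1)) : C(Circle × I, LinearStratifold m n φ ψ) :=
  (mk m n φ ψ).comp ⟨fun x ↦ sheetL i x.1 x.2, by unfold sheetL; fun_prop⟩

/-- The map of the cylinder on the right of `C_i`. -/
noncomputable def sheetRMap (i : Fin (s + 1)) : C(Circle × I, LinearStratifold m n φ ψ) :=
  (mk m n φ ψ).comp ⟨fun x ↦ sheetR i x.1 x.2, by unfold sheetR; fun_prop⟩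

/-- The inclusion of the first disk. -/
noncomputable def firstMap : C(Disk, LinearStratifold m n φ ψ) :=
  (mk m n φ ψ).comp ⟨firstDisk, by unfold firstDisk; fun_prop⟩

/-- The inclusion of the last disk. -/
noncomputable def lastMap : C(Disk, LinearStratifold m n φ ψ) :=
  (mk m n φ ψ).comp ⟨lastDisk, by unfold lastDisk; fun_prop⟩

/-- The inclusion of an annulus. -/
noncomputable def annulusMap (k : Fin s) : C(Circle × I, LinearStratifold m n φ ψ) :=
  (mk m n φ ψ).comp ⟨fun x ↦ annulus k x.1 x.2, by unfold annulus; fun_prop⟩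

variable {m n φ ψ}

theorem sheetLMap_zero (i : Fin (s + 1)) (z : Circle) :
    sheetLMap m n φ ψ i (z, 0) = coreMap m n φ ψ i (z ^ m i) := Quot.sound (.coverL i z)

theorem sheetRMap_zero (i : Fin (s + 1)) (z : Circle) :
    sheetRMap m n φ ψ i (z, 0) = coreMap m n φ ψ i (z ^ n i) := Quot.sound (.coverR i z)

theorem sheetLMap_first (z : Circle) :
    sheetLMap m n φ ψ 0 (z, 1) = firstMap m n φ ψ (boundary (φ 0 z)) := Quot.sound (.first z)

theorem sheetRMap_last (z : Circle) :
    sheetRMap m n φ ψ (Fin.last s) (z, 1) = lastMap m n φ ψ (boundary (ψ (Fin.last s) z)) :=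
  Quot.sound (.last z)

theorem sheetRMap_castSucc (k : Fin s) (z : Circle) :
    sheetRMap m n φ ψ k.castSucc (z, 1) = annulusMap m n φ ψ k (ψ k.castSucc z, 0) :=
  Quot.sound (.annulusL k z)

theorem sheetLMap_succ (k : Fin s) (z : Circle) :
    sheetLMap m n φ ψ k.succ (z, 1) = annulusMap m n φ ψ k (φ k.succ z, 1) :=
  Quot.sound (.annulusR k z)

/-- Every point lies in one of the pieces. -/
theorem ind {P : LinearStratifold m n φ ψ → Prop} (hc : ∀ i z, P (coreMap m n φ ψ i z))
    (hl : ∀ i x, P (sheetLMap m n φ ψ i x)) (hr : ∀ i x, P (sheetRMap m n φ ψ i x))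
    (hd : ∀ x, P (firstMap m n φ ψ x)) (he : ∀ x, P (lastMap m n φ ψ x))
    (ha : ∀ k x, P (annulusMap m n φ ψ k x)) (x : LinearStratifold m n φ ψ) : P x := by
  induction x using Quot.ind with
  | mk x =>
    rcases x with ⟨i, z⟩ | ⟨_ | _, i, z, t⟩ | ⟨_ | _, x⟩ | ⟨k, z, t⟩
    · exact hc i z
    · exact hl i (z, t)
    · exact hr i (z, t)
    · exact hd x
    · exact he x
    · exact ha k (z, t)

section lift

variable {Z : Type*} [TopologicalSpace Z] (c : Fin (s + 1) → C(Circle, Z))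
  (l r : Fin (s + 1) → C(Circle × I, Z)) (d e : C(Disk, Z)) (a : Fin s → C(Circle × I, Z))

/-- The map on the disjoint union of the pieces given by maps of the pieces. -/
noncomputable def piecesMap : Pieces s → Z :=
  Sum.elim (fun x ↦ c x.1 x.2) (Sum.elim (fun x ↦ cond x.1 (r x.2.1) (l x.2.1) x.2.2)
    (Sum.elim (fun x ↦ cond x.1 e d x.2) (fun x ↦ a x.1 x.2)))

theorem continuous_piecesMap : Continuous (piecesMap c l r d e a) := by
  refine Continuous.sumElim ?_ (Continuous.sumElim ?_ (Continuous.sumElim ?_ ?_))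
  · exact continuous_prod_of_discrete_left.2 fun i ↦ (c i).continuous
  · refine continuous_prod_of_discrete_left.2 fun b ↦ continuous_prod_of_discrete_left.2 fun i ↦ ?_
    exact (cond b (r i) (l i)).continuous
  · exact continuous_prod_of_discrete_left.2 fun b ↦ (cond b e d).continuous
  · exact continuous_prod_of_discrete_left.2 fun i ↦ (a i).continuous

/-- Compatibility of maps of the pieces with the identifications. -/
structure Compatible : Prop where
  coverL : ∀ i z, l i (z, 0) = c i (z ^ m i)
  coverR : ∀ i z, r i (z, 0) = c i (z ^ n i)
  first : ∀ z, l 0 (z, 1) = d (boundary (φ 0 z))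
  last : ∀ z, r (Fin.last s) (z, 1) = e (boundary (ψ (Fin.last s) z))
  annulusL : ∀ (k : Fin s) z, r k.castSucc (z, 1) = a k (ψ k.castSucc z, 0)
  annulusR : ∀ (k : Fin s) z, l k.succ (z, 1) = a k (φ k.succ z, 1)

variable {c l r d e a}

/-- The map of the stratifold given by compatible maps of the pieces. -/
noncomputable def lift (h : Compatible (m := m) (n := n) (φ := φ) (ψ := ψ) c l r d e a) :
    C(LinearStratifold m n φ ψ, Z) where
  toFun := Quot.lift (piecesMap c l r d e a) (by
    rintro _ _ (⟨i, z⟩ | ⟨i, z⟩ | z | z | ⟨k, z⟩ | ⟨k, z⟩)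
    · exact h.coverL i z
    · exact h.coverR i z
    · exact h.first z
    · exact h.last z
    · exact h.annulusL k z
    · exact h.annulusR k z)
  continuous_toFun := continuous_quot_lift _ (continuous_piecesMap c l r d e a)

end lift

/-- The `k`-th power map of the circle. -/
noncomputable def powMap (k : ℕ) : C(Circle, Circle) := ⟨fun z ↦ z ^ k, continuous_pow k⟩

/-- A family of maps of the circles `C_i` extends to the stratifold if the induced maps of the
boundary circles extend to the disks and are homotopic along the annuli. -/
theorem exists_extension {Z : Type*} [TopologicalSpace Z] (c : Fin (s + 1) → C(Circle, Z))
    (hd : ∃ d : C(Disk, Z), ∀ z, d (boundary z) = c 0 ((φ 0).symm z ^ m 0))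
    (he : ∃ e : C(Disk, Z), ∀ z, e (boundary z) =
      c (Fin.last s) ((ψ (Fin.last s)).symm z ^ n (Fin.last s)))
    (ha : ∀ k : Fin s,
      ((c k.castSucc).comp ((powMap (n k.castSucc)).comp
        ((ψ k.castSucc).symm : C(Circle, Circle)))).Homotopic
        ((c k.succ).comp ((powMap (m k.succ)).comp ((φ k.succ).symm : C(Circle, Circle))))) :
    ∃ g : C(LinearStratifold m n φ ψ, Z), ∀ i z, g (coreMap m n φ ψ i z) = c i z := by
  obtain ⟨d, hd⟩ := hd
  obtain ⟨e, he⟩ := he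
  have H (k : Fin s) := (ha k).some
  -- The sheets ignore the cylinder coordinate, and each annulus carries the given homotopy.
  have h : Compatible (m := m) (n := n) (φ := φ) (ψ := ψ) c
      (fun i ↦ (c i).comp ((powMap (m i)).comp ContinuousMap.fst))
      (fun i ↦ (c i).comp ((powMap (n i)).comp ContinuousMap.fst)) d e
      (fun k ↦ (H k).toContinuousMap.comp ContinuousMap.prodSwap) := by
    refine ⟨fun i z ↦ rfl, fun i z ↦ rfl, fun z ↦ ?_, fun z ↦ ?_, fun k z ↦ ?_, fun k z ↦ ?_⟩
    · rw [hd, Homeomorph.symm_apply_apply]; rfl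
    · rw [he, Homeomorph.symm_apply_apply]; rfl
    · refine Eq.trans ?_ ((H k).apply_zero (ψ k.castSucc z)).symm
      change _ = c k.castSucc ((ψ k.castSucc).symm (ψ k.castSucc z) ^ n k.castSucc)
      rw [Homeomorph.symm_apply_apply]; rfl
    · refine Eq.trans ?_ ((H k).apply_one (φ k.succ z)).symm
      change _ = c k.succ ((φ k.succ).symm (φ k.succ z) ^ m k.succ)
      rw [Homeomorph.symm_apply_apply]; rfl
  exact ⟨lift h, fun i z ↦ rfl⟩

end LinearStratifold

end

/-! ### Vanishing of `H1` implies coprimality. -/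

section

open CategoryTheory Limits

namespace LinearStratifold

variable {s : ℕ} {m n : Fin (s + 1) → ℕ} {φ ψ : Fin (s + 1) → Circle ≃ₜ Circle}

/-- Integers on which the relations of the annuli between `b_i` and `b_j` hold. -/
theorem exists_weights {p : ℕ} (hp : p.Prime) (ε : Fin s → ℤ) (i j : Fin (s + 1))
    (hm : ∀ k, i < k → k ≤ j → ¬ p ∣ m k) :
    ∃ a : Fin (s + 1) → ℤ, ¬ (p : ℤ) ∣ a i ∧ ∀ k : Fin s, i ≤ k.castSucc → k.succ ≤ j →
      m k.succ * a k.succ = ε k * (n k.castSucc * a k.castSucc) := by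
  have key (t : ℕ) : ∃ a : Fin (s + 1) → ℤ, ¬ (p : ℤ) ∣ a i ∧ ∀ k : Fin s, k.val < t →
      i ≤ k.castSucc → k.succ ≤ j →
      m k.succ * a k.succ = ε k * (n k.castSucc * a k.castSucc) := by
    induction t with
    | zero => exact ⟨1, by simpa [Int.natCast_dvd, Nat.dvd_one] using hp.one_lt.ne', fun k hk ↦ absurd hk (Nat.not_lt_zero _)⟩
    | succ t ih =>
      obtain ⟨a, hai, ha⟩ := ih
      by_cases h : ∃ k : Fin s, k.val = t ∧ i ≤ k.castSucc ∧ k.succ ≤ j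
      · obtain ⟨k₀, rfl, hi, hj⟩ := h
        -- To satisfy one more relation, scale all earlier weights by `m k₀.succ`. This keeps the
        -- old relations, and keeps `a i` prime to `p` because `p` does not divide that label.
        refine ⟨fun l ↦ if l ≤ k₀.castSucc then m k₀.succ * a l else
          ε k₀ * (n k₀.castSucc * a k₀.castSucc), ?_, fun k hk hki hkj ↦ ?_⟩
        · simp only [if_pos hi]
          intro h
          rcases (Nat.prime_iff_prime_int.1 hp).dvd_or_dvd h with h | h
          · refine hm k₀.succ ?_ hj (Int.natCast_dvd_natCast.1 h)
            exact lt_of_le_of_lt hi k₀.castSucc_lt_succ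
          · exact hai h
        · rcases Nat.lt_succ_iff_lt_or_eq.1 hk with hk' | hk'
          · have h1 : k.succ ≤ k₀.castSucc := by
              rw [Fin.le_def]; simp; omega
            have h2 : k.castSucc ≤ k₀.castSucc := by
              rw [Fin.le_def]; simp; omega
            have := ha k hk' hki hkj
            simp only [if_pos h1, if_pos h2]
            linear_combination (m k₀.succ : ℤ) * this
          · obtain rfl : k = k₀ := Fin.ext hk'
            have h1 : ¬ k.succ ≤ k.castSucc := by
              rw [Fin.le_def]; simp
            simp only [if_neg h1, le_refl, if_true]
            ring
      · refine ⟨a, hai, fun k hk hki hkj ↦ ha k ?_ hki hkj⟩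
        rcases Nat.lt_succ_iff_lt_or_eq.1 hk with hk' | hk'
        · exact hk'
        · exact absurd ⟨k, hk', hki, hkj⟩ h
  obtain ⟨a, hai, ha⟩ := key s
  exact ⟨a, hai, fun k ↦ ha k k.2⟩

/-- A loop in the lens space that winds around a multiple of `p` times lifts. -/
theorem lensLoop_eq_proj {p : ℕ} {j : C(Circle, LensSpace p)}
    (hj : ∀ z, j (z ^ p) = LensSpace.proj p (PuncturedPlane.left z)) {M : ℕ} (hM : p ∣ M)
    (θ : C(Circle, Circle)) (a : ℤ) :
    ∃ u : C(Circle, Circle), (j.comp (Circle.zpowMap a)).comp ((powMap M).comp θ) =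
      (LensSpace.proj p).comp (PuncturedPlane.left.comp u) := by
  obtain ⟨q, rfl⟩ := hM
  refine ⟨(Circle.zpowMap (q * a)).comp θ, ?_⟩
  ext z
  change j ((θ z ^ (p * q)) ^ a) = LensSpace.proj p (PuncturedPlane.left (θ z ^ (q * a)))
  rw [← hj]
  congr 1
  rw [← zpow_natCast, ← zpow_natCast, ← zpow_mul, ← zpow_mul]
  congr 1
  push_cast
  ring

/-- Each side is homotopic to a power map, whose exponent is the product of the degrees. -/
theorem homotopic_zpow_of_eq {θ η : Circle ≃ₜ Circle} {α β : ℤ}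
    (hθ : (θ : C(Circle, Circle)).Homotopic (Circle.zpowMap α))
    (hη : (η : C(Circle, Circle)).Homotopic (Circle.zpowMap β)) {M N : ℕ} {a b : ℤ}
    (h : N * a * α = M * b * β) :
    ((Circle.zpowMap a).comp ((powMap N).comp (θ : C(Circle, Circle)))).Homotopic
      ((Circle.zpowMap b).comp ((powMap M).comp (η : C(Circle, Circle)))) := by
  have e (K : ℕ) (c γ : ℤ) : (Circle.zpowMap c).comp ((powMap K).comp (Circle.zpowMap γ)) =
      Circle.zpowMap (K * c * γ) := by
    ext z
    change ((((z ^ γ) ^ K) ^ c : Circle) : ℂ) = ((z ^ (K * c * γ) : Circle) : ℂ)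
    rw [← zpow_natCast, ← zpow_mul, ← zpow_mul]
    congr 2
    ring
  have h1 : ((Circle.zpowMap a).comp ((powMap N).comp (θ : C(Circle, Circle)))).Homotopic
      (Circle.zpowMap (N * a * α)) := by
    rw [← e]
    exact .comp (.refl _) (.comp (.refl _) hθ)
  have h2 : ((Circle.zpowMap b).comp ((powMap M).comp (η : C(Circle, Circle)))).Homotopic
      (Circle.zpowMap (M * b * β)) := by
    rw [← e]
    exact .comp (.refl _) (.comp (.refl _) hη)
  rw [h] at h1
  exact h1.trans h2.symm

/-- If `p` divides `m i` and `n j`, and no `m k` in between, there is a map to the lens space that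
winds around a number of times prime to `p` on `C_i`. -/
theorem exists_map_lensSpace {p : ℕ} (hp : p.Prime) (i j : Fin (s + 1)) (hij : i ≤ j)
    (hi : p ∣ m i) (hj : p ∣ n j) (hm : ∀ k, i < k → k ≤ j → ¬ p ∣ m k)
    (w : C(Circle, LensSpace p))
    (hw : ∀ z, w (z ^ p) = LensSpace.proj p (PuncturedPlane.left z)) :
    ∃ (g : C(LinearStratifold m n φ ψ, LensSpace p)) (a : ℤ), ¬ (p : ℤ) ∣ a ∧
      ∀ z, g (coreMap m n φ ψ i z) = w (z ^ a) := by
  choose α hα hα' using fun k : Fin s ↦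
    Circle.exists_isUnit_homotopic_zpowMap (ψ k.castSucc).symm
  choose β hβ hβ' using fun k : Fin s ↦
    Circle.exists_isUnit_homotopic_zpowMap (φ k.succ).symm
  obtain ⟨a, hai, ha⟩ := exists_weights (m := m) (n := n) hp (fun k ↦ β k * α k) i j hm
  let y₀ : LensSpace p := LensSpace.proj p PuncturedPlane.apex
  let c (k : Fin (s + 1)) : C(Circle, LensSpace p) :=
    if i ≤ k ∧ k ≤ j then w.comp (Circle.zpowMap (a k)) else .const _ y₀
  have c_in {k : Fin (s + 1)} (h₁ : i ≤ k) (h₂ : k ≤ j) : c k = w.comp (Circle.zpowMap (a k)) :=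
    if_pos ⟨h₁, h₂⟩
  have c_out {k : Fin (s + 1)} (h : ¬ (i ≤ k ∧ k ≤ j)) : c k = .const _ y₀ := if_neg h
  -- A terminal disk meets the range only if `i` is the first index or `j` the last, and then `p`
  -- divides the label on that side.
  have disk {k : Fin (s + 1)} {M : ℕ} (θ : C(Circle, Circle))
      (h : i ≤ k ∧ k ≤ j → p ∣ M) :
      ∃ d : C(Disk, LensSpace p), ∀ z, d (boundary z) = (c k).comp ((powMap M).comp θ) z := by
    by_cases hk : i ≤ k ∧ k ≤ j
    · obtain ⟨u, hu⟩ := lensLoop_eq_proj hw (h hk) θ (a k)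
      obtain ⟨d, hd⟩ := PuncturedPlane.exists_disk_extension u
      refine ⟨(LensSpace.proj p).comp d, fun z ↦ ?_⟩
      rw [c_in hk.1 hk.2, hu, ContinuousMap.comp_apply, hd]
      rfl
    · exact ⟨.const _ y₀, fun z ↦ by rw [c_out hk]; rfl⟩
  -- For the annuli just outside the range: one boundary winds a multiple of `p` times, the other is
  -- constant.
  have null {k : Fin (s + 1)} {M : ℕ} (θ : C(Circle, Circle)) (h₁ : i ≤ k) (h₂ : k ≤ j)
      (h : p ∣ M) : ((c k).comp ((powMap M).comp θ)).Homotopic (.const _ y₀) := by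
    obtain ⟨u, hu⟩ := lensLoop_eq_proj hw h θ (a k)
    rw [c_in h₁ h₂, hu]
    exact .comp (.refl _) (PuncturedPlane.left_homotopic_const u)
  obtain ⟨g, hg⟩ := exists_extension (m := m) (n := n) (φ := φ) (ψ := ψ) c
    (disk ((φ 0).symm : C(Circle, Circle)) fun h ↦ by
      rwa [← Fin.le_zero_iff.1 h.1])
    (disk ((ψ (Fin.last s)).symm : C(Circle, Circle)) fun h ↦ by
      rwa [← Fin.last_le_iff.1 h.2])
    (fun k ↦ by
      by_cases h₁ : i ≤ k.castSucc ∧ k.castSucc ≤ j <;> by_cases h₂ : i ≤ k.succ ∧ k.succ ≤ j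
      · rw [c_in h₁.1 h₁.2, c_in h₂.1 h₂.2, ContinuousMap.comp_assoc, ContinuousMap.comp_assoc]
        refine .comp (.refl w) (homotopic_zpow_of_eq (hα' k) (hβ' k) ?_)
        have := ha k h₁.1 h₂.2
        -- The degrees are signs, so they may be moved across the relation between the weights.
        rcases Int.isUnit_iff.1 (hα k) with h | h <;> rcases Int.isUnit_iff.1 (hβ k) with h' | h' <;>
          rw [h, h'] at this ⊢ <;> linarith
      · rw [c_out h₂]
        refine null _ h₁.1 h₁.2 ?_
        have : k.castSucc = j := by
          refine le_antisymm h₁.2 (not_lt.1 fun h ↦ h₂ ⟨?_, ?_⟩)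
          · exact h₁.1.trans k.castSucc_lt_succ.le
          · exact Fin.castSucc_lt_iff_succ_le.1 h
        rwa [this]
      · rw [c_out h₁]
        refine (null _ h₂.1 h₂.2 ?_).symm
        have : k.succ = i := by
          refine le_antisymm (not_lt.1 fun h ↦ h₁ ⟨?_, ?_⟩) h₂.1
          · exact Fin.le_castSucc_iff.2 h
          · exact k.castSucc_lt_succ.le.trans h₂.2
        rwa [this]
      · rw [c_out h₁, c_out h₂]
        exact .refl _)
  exact ⟨g, a i, hai, fun z ↦ by rw [hg, c_in le_rfl hij]; rfl⟩

theorem gcd_eq_one_of_isZero_H1 (hX : IsZero (H1 (LinearStratifold m n φ ψ)))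
    (i j : Fin (s + 1)) (hij : i ≤ j) : Nat.gcd (m i) (n j) = 1 := by
  by_contra hne
  obtain ⟨p, hp, hdvd⟩ := Nat.exists_prime_and_dvd hne
  obtain ⟨hpi, hpj⟩ := Nat.dvd_gcd_iff.1 hdvd
  have : NeZero p := ⟨hp.ne_zero⟩
  -- Replace `i` by the largest index up to `j` whose `m` is divisible by `p`.
  obtain ⟨i, ⟨hi, hij⟩, hmax⟩ := Set.Finite.exists_maximalFor id {k | p ∣ m k ∧ k ≤ j}
    (Set.toFinite _) ⟨i, hpi, hij⟩
  obtain ⟨w, hw⟩ := LensSpace.exists_loop p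
  obtain ⟨g, a, hpa, hg⟩ := exists_map_lensSpace (m := m) (n := n) (φ := φ) (ψ := ψ) hp i j hij hi
    hpj (fun k hik hkj hk ↦ (hmax ⟨hk, hkj⟩ hik.le).not_gt hik) w hw
  let σ : C(stdSimplex ℝ (Fin 2), LinearStratifold m n φ ψ) :=
    (coreMap m n φ ψ i).comp (Circle.exp.comp ⟨fun u ↦ u 1 * (2 * Real.pi), by
      exact ((continuous_apply 1).comp continuous_subtype_val).mul continuous_const⟩)
  -- Once around `C_i` maps to `a` times around `w`, which lifts to an arc of angle `2πa / p`; it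
  -- closes up only if `p` divides `a`.
  let σ' : C(stdSimplex ℝ (Fin 2), PuncturedPlane) :=
    PuncturedPlane.left.comp (Circle.exp.comp ⟨fun u ↦ u 1 * (a / p * (2 * Real.pi)), by
      exact ((continuous_apply 1).comp continuous_subtype_val).mul continuous_const⟩)
  have hp0 : (p : ℝ) ≠ 0 := Nat.cast_ne_zero.2 hp.ne_zero
  have h := (LensSpace.isQuotientCoveringMap_proj p).lift_closed_of_isZero_H1 hX g σ
    (by simp [σ]) σ' (fun u ↦ by
      change LensSpace.proj p (PuncturedPlane.left (Circle.exp (u 1 * (a / p * (2 * Real.pi))))) =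
        g (coreMap m n φ ψ i (Circle.exp (u 1 * (2 * Real.pi))))
      rw [hg, ← hw, Circle.exp_zpow, ← zpow_natCast, Circle.exp_zpow]
      congr 2
      push_cast
      field_simp)
  have h1 : Circle.exp (a / p * (2 * Real.pi)) = 1 := by
    have h2 : Circle.exp ((0 : ℝ) * (a / p * (2 * Real.pi))) =
      Circle.exp ((1 : ℝ) * (a / p * (2 * Real.pi))) := PuncturedPlane.left_injective h
    rw [zero_mul, one_mul, Circle.exp_zero] at h2
    exact h2.symm
  obtain ⟨k, hk⟩ := Circle.exp_eq_one.1 h1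
  have h2 := mul_right_cancel₀ (by positivity) hk
  rw [div_eq_iff hp0] at h2
  exact hpa ⟨k, by rw [mul_comm]; exact_mod_cast h2⟩

end LinearStratifold

end

/-! ### Powers killed by maps on fundamental groups; powers of loops in the circle. -/

section

open CategoryTheory unitInterval

section KillsPow

variable {K L X : Type*} [TopologicalSpace K] [TopologicalSpace L] [TopologicalSpace X]

/-- The `M`-th powers of the elements in the image of a map on fundamental groups are trivial. -/
def KillsPow (f : C(K, X)) (M : ℕ) : Prop :=
  ∀ (x : FundamentalGroupoid K) (g : End x), (FundamentalGroupoid.map f).mapEnd x g ^ M = 1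

/-- A free homotopy changes the image of a loop by conjugation with the track of the base point;
quantifying over all base points makes this harmless. -/
theorem KillsPow.of_homotopic {f f' : C(K, X)} {M : ℕ} (h : KillsPow f M) (H : f.Homotopic f') :
    KillsPow f' M := by
  intro x g
  let e := asIso ((FundamentalGroupoidFunctor.homotopicMapsNatIso H.some).app x)
  have : (FundamentalGroupoid.map f').mapEnd x g = e.conj ((FundamentalGroupoid.map f).mapEnd x g) := by
    rw [Iso.conj_apply, Iso.eq_inv_comp]
    exact ((FundamentalGroupoidFunctor.homotopicMapsNatIso H.some).naturality g).symm
  rw [this, ← Iso.conj_pow, h x g, map_one]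

theorem KillsPow.comp {f : C(L, X)} {M : ℕ} (h : KillsPow f M) (u : C(K, L)) :
    KillsPow (f.comp u) M := by
  intro x g
  refine (congrArg (· ^ M) ?_).trans
    (h ((FundamentalGroupoid.map u).obj x) ((FundamentalGroupoid.map u).map g))
  exact Path.Homotopic.Quotient.map_comp

theorem killsPow_one_of_simplyConnectedSpace [SimplyConnectedSpace K] (f : C(K, X)) :
    KillsPow f 1 := by
  rintro ⟨x⟩ g
  have : Subsingleton (End (FundamentalGroupoid.mk x)) :=
    inferInstanceAs (Subsingleton (FundamentalGroup K x))
  rw [Subsingleton.elim g 1, map_one, one_pow]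

theorem KillsPow.of_coprime {f : C(K, X)} {M N : ℕ} (hM : KillsPow f M) (hN : KillsPow f N)
    (h : Nat.Coprime M N) : KillsPow f 1 := by
  intro x g
  rw [← h.gcd_eq_one]
  exact pow_gcd_eq_one.2 ⟨hM x g, hN x g⟩

theorem killsPow_of_basepoint [PathConnectedSpace K] {f : C(K, X)} {M : ℕ} (x : K)
    (h : ∀ g : End (FundamentalGroupoid.mk x), (FundamentalGroupoid.map f).mapEnd _ g ^ M = 1) :
    KillsPow f M := by
  rintro ⟨y⟩ g
  let e : FundamentalGroupoid.mk y ≅ FundamentalGroupoid.mk x :=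
    (Groupoid.isoEquivHom ..).symm ⟦PathConnectedSpace.somePath y x⟧
  have h1 := h (e.conj g)
  rw [show (FundamentalGroupoid.map f).mapEnd _ (e.conj g) =
    ((FundamentalGroupoid.map f).mapIso e).conj ((FundamentalGroupoid.map f).mapEnd _ g) from
    (FundamentalGroupoid.map f).map_conj e g, ← Iso.conj_pow] at h1
  exact (map_eq_one_iff _ (MulEquiv.injective _)).1 h1

theorem KillsPow.homotopic_map {f : C(K, X)} (h : KillsPow f 1) {x y : K} (p q : Path x y) :
    (p.map f.continuous).Homotopic (q.map f.continuous) := by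
  let P : FundamentalGroupoid.mk x ⟶ FundamentalGroupoid.mk y := Path.Homotopic.Quotient.mk p
  let Q : FundamentalGroupoid.mk x ⟶ FundamentalGroupoid.mk y := Path.Homotopic.Quotient.mk q
  have h1 : (FundamentalGroupoid.map f).map (P ≫ inv Q) = 𝟙 _ := by
    have := h _ (P ≫ inv Q)
    rwa [pow_one] at this
  rw [Functor.map_comp, Functor.map_inv, IsIso.comp_inv_eq, Category.id_comp] at h1
  exact Path.Homotopic.Quotient.exact h1

end KillsPow

namespace Path

/-- In a topological group, the pointwise product of loops is homotopic to the concatenation. -/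
theorem homotopic_mul_trans {G : Type*} [TopologicalSpace G] [Group G] [ContinuousMul G]
    (p q : Path (1 : G) 1) :
    ((p.mul q).cast (one_mul 1).symm (one_mul 1).symm).Homotopic (q.trans p) := by
  -- Delay `p` to the second half and hurry `q` into the first: at each time one factor is `1`, and
  -- the product is the concatenation.
  have h1 : ((p.mul q).cast (one_mul 1).symm (one_mul 1).symm).Homotopic
      ((((Path.refl 1).trans p).mul (q.trans (Path.refl 1))).cast (one_mul 1).symm
        (one_mul 1).symm) := by
    refine Path.Homotopic.pathCast ?_ _ _
    exact Path.Homotopic.map ⟨Path.Homotopic.prodHomotopy (Path.Homotopy.reflTrans p).symm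
      (Path.Homotopy.transRefl q).symm⟩ ⟨fun x : G × G ↦ x.1 * x.2, continuous_mul⟩
  convert h1 using 1
  ext t
  simp only [Path.cast_coe, Path.mul, Path.map_coe, Function.comp_apply, Path.prod_coe,
    Path.trans_apply]
  split_ifs <;> simp

end Path

section Circle

open LinearStratifold

theorem powMap_one (k : ℕ) : powMap k 1 = 1 := one_pow k

theorem mapOfEq_powMap (k : ℕ) (g : FundamentalGroup Circle 1) :
    FundamentalGroup.mapOfEq (powMap k) (powMap_one k) g = g ^ k := by
  obtain ⟨p, rfl⟩ : ∃ p : Path (1 : Circle) 1,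
    FundamentalGroup.fromPath (Path.Homotopic.Quotient.mk p) = g :=
      Path.Homotopic.Quotient.mk_surjective g
  have key (k : ℕ) : FundamentalGroup.mapOfEq (powMap k) (powMap_one k)
      (FundamentalGroup.fromPath (Path.Homotopic.Quotient.mk p)) =
      FundamentalGroup.fromPath (Path.Homotopic.Quotient.mk
        ((p.map (powMap k).continuous).cast (powMap_one k).symm (powMap_one k).symm)) :=
    FundamentalGroup.mapOfEq_apply ..
  induction k with
  | zero =>
    rw [pow_zero, key]
    refine congrArg Path.Homotopic.Quotient.mk ?_
    ext t
    change ((p t ^ 0 : Circle) : ℂ) = ((1 : Circle) : ℂ)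
    rw [pow_zero]
  | succ k ih =>
    rw [pow_succ, ← ih, key, key]
    refine Eq.trans (congrArg Path.Homotopic.Quotient.mk ?_)
      (Path.Homotopic.Quotient.eq.2 (Path.homotopic_mul_trans
        ((p.map (powMap k).continuous).cast (powMap_one k).symm (powMap_one k).symm) p))
    ext t
    change ((p t ^ (k + 1) : Circle) : ℂ) = ((p t ^ k * p t : Circle) : ℂ)
    rw [pow_succ]

/-- The `k`-th power of a loop is its image under `z ↦ z ^ k`. The isomorphism `e` is there only
because that image is based at `1 ^ k`. -/
theorem KillsPow.of_comp_powMap {X : Type*} [TopologicalSpace X] {f : C(Circle, X)} {k M : ℕ}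
    (h : KillsPow (f.comp (powMap k)) M) : KillsPow f (k * M) := by
  refine killsPow_of_basepoint 1 fun g ↦ ?_
  let e : FundamentalGroupoid.mk ((1 : Circle) ^ k) ≅ FundamentalGroupoid.mk 1 :=
    eqToIso (congrArg FundamentalGroupoid.mk (one_pow k))
  let g' : End (FundamentalGroupoid.mk ((1 : Circle) ^ k)) := FundamentalGroup.map (powMap k) 1 g
  have h1 : g ^ k = e.conj g' := (mapOfEq_powMap k g).symm
  have h2 : (FundamentalGroupoid.map f).mapEnd _ g' ^ M = 1 := by
    refine (congrArg (· ^ M) ?_).trans (h ⟨1⟩ g)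
    symm
    exact Path.Homotopic.Quotient.map_comp
  rw [pow_mul, ← map_pow, h1, show (FundamentalGroupoid.map f).mapEnd _ (e.conj g') =
    ((FundamentalGroupoid.map f).mapIso e).conj ((FundamentalGroupoid.map f).mapEnd _ g') from
    (FundamentalGroupoid.map f).map_conj e g', ← Iso.conj_pow, h2, map_one]

end Circle

end

/-! ### Thin sets and a weak van Kampen theorem. -/

section

open unitInterval Topology Filter Path.Homotopic.Quotient

/-- A path connected set such that any two paths in it with the same end points are homotopic in
the ambient space. -/
structure IsThin {X : Type*} [TopologicalSpace X] (U : Set X) : Prop where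
  intro ::
  isPathConnected : IsPathConnected U
  homotopic : ∀ {x y : X} (p q : Path x y), (∀ t, p t ∈ U) → (∀ t, q t ∈ U) → p.Homotopic q

namespace IsThin

variable {X : Type*} [TopologicalSpace X] {U V : Set X}

theorem simplyConnectedSpace (h : IsThin (Set.univ : Set X)) : SimplyConnectedSpace X :=
  simply_connected_iff_paths_homotopic'.2
    ⟨pathConnectedSpace_iff_univ.2 h.isPathConnected, fun p q ↦
      h.homotopic p q (fun _ ↦ trivial) fun _ ↦ trivial⟩

/-- A class of paths from the base point to a point of the union that agrees with all paths in
either set. -/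
theorem exists_class (hU : IsThin U) (hV : IsThin V) (hUV : IsPathConnected (U ∩ V)) {x₀ : X}
    (hx₀ : x₀ ∈ U ∩ V) (x : X) (hx : x ∈ U ∪ V) : ∃ γ : Path.Homotopic.Quotient x₀ x,
      (∀ q : Path x₀ x, (∀ t, q t ∈ U) → mk q = γ) ∧
        ∀ q : Path x₀ x, (∀ t, q t ∈ V) → mk q = γ := by
  by_cases hxU : x ∈ U
  · obtain ⟨p, hp⟩ := hU.isPathConnected.joinedIn x₀ hx₀.1 x hxU
    refine ⟨mk p, fun q hq ↦ eq.2 (hU.homotopic q p hq hp), fun q hq ↦ ?_⟩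
    have hxV : x ∈ V := by simpa using hq 1
    obtain ⟨r, hr⟩ := hUV.joinedIn x₀ hx₀ x ⟨hxU, hxV⟩
    exact eq.2 ((hV.homotopic q r hq fun t ↦ (hr t).2).trans
      (hU.homotopic r p (fun t ↦ (hr t).1) hp))
  · have hxV : x ∈ V := hx.resolve_left hxU
    obtain ⟨p, hp⟩ := hV.isPathConnected.joinedIn x₀ hx₀.2 x hxV
    refine ⟨mk p, fun q hq ↦ absurd ?_ hxU, fun q hq ↦ eq.2 (hV.homotopic q p hq hp)⟩
    simpa using hq 1

theorem trans_mem {x y z : X} {p : Path x y} {q : Path y z} (hp : ∀ t, p t ∈ U)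
    (hq : ∀ t, q t ∈ U) (t : I) : p.trans q t ∈ U := by
  rw [Path.trans_apply]
  split_ifs
  · exact hp _
  · exact hq _

theorem class_trans_cast {S : Set X} {x₀ : X}
    (γ : ∀ x, x ∈ S → Path.Homotopic.Quotient x₀ x) {x y x' y' : X} (hx : x' = x) (hy : y' = y)
    (p : Path x y) (hx' : x' ∈ S) (hy' : y' ∈ S)
    (h : (γ x' hx').trans (mk (p.cast hx hy)) = γ y' hy') :
    (γ x (hx ▸ hx')).trans (mk p) = γ y (hy ▸ hy') := by
  subst hx hy
  exact h

/-- With `γ x` the common class of paths from `x₀` to `x` inside `U` or inside `V`, every path `p`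
in the union satisfies `γ x * [p] = γ y`. Hence `[p]` depends only on its end points. -/
theorem union (hU : IsThin U) (hV : IsThin V) (hUo : IsOpen U) (hVo : IsOpen V)
    (hUV : IsPathConnected (U ∩ V)) : IsThin (U ∪ V) := by
  refine ⟨hU.isPathConnected.union hV.isPathConnected hUV.nonempty, ?_⟩
  obtain ⟨x₀, hx₀⟩ := hUV.nonempty
  choose γ hγU hγV using exists_class hU hV hUV hx₀
  have step {x y : X} (q : Path x y) (hx : x ∈ U ∪ V) (hy : y ∈ U ∪ V)
      (h : (∀ t, q t ∈ U) ∨ ∀ t, q t ∈ V) : (γ x hx).trans (mk q) = γ y hy := by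
    rcases h with h | h
    · have hxU : x ∈ U := by simpa using h 0
      obtain ⟨p, hp⟩ := hU.isPathConnected.joinedIn x₀ hx₀.1 x hxU
      rw [← hγU x hx p hp, ← mk_trans]
      exact hγU y hy _ (trans_mem hp h)
    · have hxV : x ∈ V := by simpa using h 0
      obtain ⟨p, hp⟩ := hV.isPathConnected.joinedIn x₀ hx₀.2 x hxV
      rw [← hγV x hx p hp, ← mk_trans]
      exact hγV y hy _ (trans_mem hp h)
  have key {x y : X} (p : Path x y) (hp : ∀ t, p t ∈ U ∪ V) :
      (γ x (by simpa using hp 0)).trans (mk p) = γ y (by simpa using hp 1) := by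
    -- Go to `p t` by `γ`, then follow `p` to its end. Short pieces of `p` stay in `U` or in `V`, so
    -- this class is locally constant in `t`, and its values at `0` and `1` agree.
    let h (t : I) : Path.Homotopic.Quotient x₀ (p 1) := (γ (p t) (hp t)).trans (mk (p.subpath t 1))
    have hstep (t t' : I) (H : p '' Set.uIcc t t' ⊆ U ∨ p '' Set.uIcc t t' ⊆ V) : h t' = h t := by
      have h1 : mk (p.subpath t 1) = (mk (p.subpath t t')).trans (mk (p.subpath t' 1)) := by
        rw [← mk_trans]
        exact eq.2 ⟨(Path.Homotopy.subpathTransSubpath p t t' 1).symm⟩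
      simp only [h]
      rw [h1, ← trans_assoc, step (p.subpath t t') (hp t) (hp t')]
      rw [← Path.range_subpath] at H
      exact H.imp (fun H t ↦ H ⟨t, rfl⟩) fun H t ↦ H ⟨t, rfl⟩
    have hloc : IsLocallyConstant h := by
      refine (IsLocallyConstant.iff_eventually_eq h).2 fun t ↦ ?_
      have hu : Tendsto (fun t' ↦ Set.uIcc t t') (𝓝 t) (𝓝 t).smallSets :=
        tendsto_const_nhds.uIcc tendsto_id
      have aux {W : Set X} (hW : IsOpen W) (ht : p t ∈ W) : ∀ᶠ t' in 𝓝 t,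
          p '' Set.uIcc t t' ⊆ W := by
        have hW' : p ⁻¹' W ∈ 𝓝 t := p.continuous.continuousAt (hW.mem_nhds ht)
        filter_upwards [hu.eventually (eventually_smallSets_subset.2 hW')] with t' ht'
        exact Set.image_subset_iff.2 ht'
      rcases hp t with ht | ht
      · filter_upwards [aux hUo ht] with t' ht' using hstep t t' (Or.inl ht')
      · filter_upwards [aux hVo ht] with t' ht' using hstep t t' (Or.inr ht')
    have h01 : h 0 = h 1 := hloc.apply_eq_of_preconnectedSpace 0 1
    refine class_trans_cast γ p.source p.target p (hp 0) (hp 1) ?_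
    simp only [h] at h01
    rw [Path.subpath_self, Path.subpath_zero_one, mk_refl, trans_refl] at h01
    exact h01
  intro x y p q hp hq
  have h1 := (key p hp).trans (key q hq).symm
  rw [← eq]
  have h2 := congrArg (Path.Homotopic.Quotient.trans (γ x (by simpa using hp 0)).symm) h1
  rwa [← trans_assoc, ← trans_assoc, symm_trans, refl_trans, refl_trans] at h2

/-- A path connected set is thin if it is pushed by a homotopy of the ambient space into the image
of an embedding that is trivial on fundamental groups. -/
theorem of_homotopy {K : Type*} [TopologicalSpace K] (hU : IsPathConnected U) {f : C(K, X)}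
    (hf : IsEmbedding f) (hf' : KillsPow f 1) {h : C(X, X)} (H : (ContinuousMap.id X).Homotopic h)
    (hh : ∀ x ∈ U, h x ∈ Set.range f) : IsThin U := by
  refine ⟨hU, fun {x y} p q hp hq ↦ ?_⟩
  let e := hf.toHomeomorph
  -- The embedding makes the pushed path continuous in `K`, where `hf'` applies.
  have lift_path (r : Path x y) (hr : ∀ t, r t ∈ U) :
      ∃ r' : C(I, K), ∀ t, f (r' t) = h (r t) := by
    refine ⟨⟨fun t ↦ e.symm ⟨h (r t), hh _ (hr t)⟩, by fun_prop⟩, fun t ↦ ?_⟩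
    exact congrArg Subtype.val (e.apply_symm_apply ⟨h (r t), hh _ (hr t)⟩)
  obtain ⟨p', hp'⟩ := lift_path p hp
  obtain ⟨q', hq'⟩ := lift_path q hq
  let P : Path (p' 0) (p' 1) := ⟨p', rfl, rfl⟩
  let Q : Path (p' 0) (p' 1) := ⟨q', hf.injective ((hq' 0).trans (by rw [hp', p.source, q.source])),
    hf.injective ((hq' 1).trans (by rw [hp', p.target, q.target]))⟩
  have h1 : (p.map h.continuous).Homotopic (q.map h.continuous) := by
    have h2 := (hf'.homotopic_map P Q).pathCast (x₂ := h x) (x₃ := h y)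
      (by rw [hp', p.source]) (by rw [hp', p.target])
    convert h2 using 1
    · ext t; exact (hp' t).symm
    · ext t; exact (hq' t).symm
  obtain ⟨F⟩ := H
  -- A path and its push differ by the tracks of the end points, which are the same for `p` and `q`.
  have hp2 := eq.2 (Path.Homotopic.map_trans_evalAt F p)
  have hq2 := eq.2 (Path.Homotopic.map_trans_evalAt F q)
  rw [mk_trans, mk_trans] at hp2 hq2
  rw [← eq.2 h1] at hq2
  have h4 := hp2.trans hq2.symm
  have h5 := congrArg (fun z ↦ Path.Homotopic.Quotient.trans z (mk (F.evalAt y)).symm) h4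
  simp only [trans_assoc, trans_symm, trans_refl] at h5
  exact exact h5

end IsThin

end

/-! ### The core circles are null-homotopic; the pieces are embedded. -/

section

open unitInterval Topology

namespace LinearStratifold

variable {s : ℕ} {m n : Fin (s + 1) → ℕ} {φ ψ : Fin (s + 1) → Circle ≃ₜ Circle}

instance : ContractibleSpace Disk :=
  (convex_closedBall (0 : ℂ) 1).contractibleSpace ⟨0, by simp⟩

/-- The map at one end of a cylinder. -/
noncomputable def endMap {X : Type*} [TopologicalSpace X] (g : C(Circle × I, X)) (t : I) : C(Circle, X) :=
  ⟨fun z ↦ g (z, t), by fun_prop⟩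

theorem endMap_homotopic {X : Type*} [TopologicalSpace X] (g : C(Circle × I, X)) :
    (endMap g 0).Homotopic (endMap g 1) :=
  ⟨⟨g.comp ContinuousMap.prodSwap, fun _ ↦ rfl, fun _ ↦ rfl⟩⟩

theorem coreMap_comp_powMap_left (i : Fin (s + 1)) :
    ((coreMap m n φ ψ i).comp (powMap (m i))).Homotopic (endMap (sheetLMap m n φ ψ i) 1) := by
  convert endMap_homotopic (sheetLMap m n φ ψ i) using 1
  ext z
  exact (sheetLMap_zero i z).symm

theorem coreMap_comp_powMap_right (i : Fin (s + 1)) :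
    ((coreMap m n φ ψ i).comp (powMap (n i))).Homotopic (endMap (sheetRMap m n φ ψ i) 1) := by
  convert endMap_homotopic (sheetRMap m n φ ψ i) using 1
  ext z
  exact (sheetRMap_zero i z).symm

theorem endMap_annulusMap_zero (k : Fin s) : endMap (annulusMap m n φ ψ k) 0 =
    (endMap (sheetRMap m n φ ψ k.castSucc) 1).comp ((ψ k.castSucc).symm : C(Circle, Circle)) := by
  ext z
  refine Eq.trans ?_ (sheetRMap_castSucc k _).symm
  simp [endMap]

theorem endMap_annulusMap_one (k : Fin s) : endMap (annulusMap m n φ ψ k) 1 =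
    (endMap (sheetLMap m n φ ψ k.succ) 1).comp ((φ k.succ).symm : C(Circle, Circle)) := by
  ext z
  refine Eq.trans ?_ (sheetLMap_succ k _).symm
  simp [endMap]

theorem endMap_sheetRMap_castSucc (k : Fin s) : endMap (sheetRMap m n φ ψ k.castSucc) 1 =
    (endMap (annulusMap m n φ ψ k) 0).comp (ψ k.castSucc : C(Circle, Circle)) := by
  ext z
  exact sheetRMap_castSucc k z

theorem endMap_sheetLMap_succ (k : Fin s) : endMap (sheetLMap m n φ ψ k.succ) 1 =
    (endMap (annulusMap m n φ ψ k) 1).comp (φ k.succ : C(Circle, Circle)) := by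
  ext z
  exact sheetLMap_succ k z

theorem killsPow_endMap_annulusMap_zero {k : Fin s} {M : ℕ}
    (h : KillsPow (coreMap m n φ ψ k.castSucc) M) :
    KillsPow (endMap (annulusMap m n φ ψ k) 0) M := by
  rw [endMap_annulusMap_zero]
  exact ((h.comp _).of_homotopic (coreMap_comp_powMap_right _)).comp _

theorem killsPow_endMap_annulusMap_one {k : Fin s} {M : ℕ}
    (h : KillsPow (coreMap m n φ ψ k.succ) M) :
    KillsPow (endMap (annulusMap m n φ ψ k) 1) M := by
  rw [endMap_annulusMap_one]
  exact ((h.comp _).of_homotopic (coreMap_comp_powMap_left _)).comp _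

/-- Slide the `m k.succ`-fold traverse of the right circle over its sheet, the annulus and the next
sheet: it becomes a loop through the left circle, already killed by `M`. -/
theorem killsPow_coreMap_succ {k : Fin s} {M : ℕ}
    (h : KillsPow (coreMap m n φ ψ k.castSucc) M) :
    KillsPow (coreMap m n φ ψ k.succ) (m k.succ * M) := by
  refine KillsPow.of_comp_powMap (KillsPow.of_homotopic ?_ (coreMap_comp_powMap_left _).symm)
  rw [endMap_sheetLMap_succ]
  exact ((killsPow_endMap_annulusMap_zero h).of_homotopic (endMap_homotopic _)).comp _

theorem killsPow_coreMap_castSucc {k : Fin s} {M : ℕ}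
    (h : KillsPow (coreMap m n φ ψ k.succ) M) :
    KillsPow (coreMap m n φ ψ k.castSucc) (n k.castSucc * M) := by
  refine KillsPow.of_comp_powMap (KillsPow.of_homotopic ?_ (coreMap_comp_powMap_right _).symm)
  rw [endMap_sheetRMap_castSucc]
  exact ((killsPow_endMap_annulusMap_one h).of_homotopic (endMap_homotopic _).symm).comp _

/-- The inclusion of the boundary circle into the disk. -/
noncomputable def boundaryMap : C(Circle, Disk) :=
  ⟨boundary, PuncturedPlane.isClosedEmbedding_boundary.continuous⟩

theorem killsPow_coreMap_zero : KillsPow (coreMap m n φ ψ 0) (m 0) := by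
  rw [← mul_one (m 0)]
  refine KillsPow.of_comp_powMap (KillsPow.of_homotopic ?_ (coreMap_comp_powMap_left _).symm)
  have : endMap (sheetLMap m n φ ψ 0) 1 =
      (firstMap m n φ ψ).comp (boundaryMap.comp (φ 0 : C(Circle, Circle))) := by
    ext z
    exact sheetLMap_first z
  rw [this]
  exact (killsPow_one_of_simplyConnectedSpace _).comp _

theorem killsPow_coreMap_last :
    KillsPow (coreMap m n φ ψ (Fin.last s)) (n (Fin.last s)) := by
  rw [← mul_one (n (Fin.last s))]
  refine KillsPow.of_comp_powMap (KillsPow.of_homotopic ?_ (coreMap_comp_powMap_right _).symm)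
  have : endMap (sheetRMap m n φ ψ (Fin.last s)) 1 =
      (lastMap m n φ ψ).comp (boundaryMap.comp (ψ (Fin.last s) : C(Circle, Circle))) := by
    ext z
    exact sheetRMap_last z
  rw [this]
  exact (killsPow_one_of_simplyConnectedSpace _).comp _

/-- `M` is the product of the `m k` with `k ≤ i`; only its coprimality property is recorded. -/
theorem exists_killsPow_left (i : Fin (s + 1)) : ∃ M, KillsPow (coreMap m n φ ψ i) M ∧
    ∀ N, (∀ k ≤ i, Nat.Coprime (m k) N) → Nat.Coprime M N := by
  induction i using Fin.induction with
  | zero => exact ⟨m 0, killsPow_coreMap_zero, fun N h ↦ h 0 le_rfl⟩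
  | succ k ih =>
    obtain ⟨M, hM, h⟩ := ih
    exact ⟨_, killsPow_coreMap_succ hM, fun N hN ↦ (hN _ le_rfl).mul_left
      (h N fun l hl ↦ hN l (hl.trans k.castSucc_lt_succ.le))⟩

theorem exists_killsPow_right (i : Fin (s + 1)) : ∃ N, KillsPow (coreMap m n φ ψ i) N ∧
    ∀ M, (∀ k ≥ i, Nat.Coprime M (n k)) → Nat.Coprime M N := by
  induction i using Fin.reverseInduction with
  | last => exact ⟨_, killsPow_coreMap_last, fun N h ↦ h _ le_rfl⟩
  | cast k ih =>
    obtain ⟨M, hM, h⟩ := ih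
    exact ⟨_, killsPow_coreMap_castSucc hM, fun N hN ↦ (hN _ le_rfl).mul_right
      (h N fun l hl ↦ hN l (k.castSucc_lt_succ.le.trans hl))⟩

theorem killsPow_coreMap (h : ∀ i j : Fin (s + 1), i ≤ j → Nat.gcd (m i) (n j) = 1)
    (i : Fin (s + 1)) : KillsPow (coreMap m n φ ψ i) 1 := by
  obtain ⟨M, hM, hM'⟩ := exists_killsPow_left (m := m) (n := n) (φ := φ) (ψ := ψ) i
  obtain ⟨N, hN, hN'⟩ := exists_killsPow_right (m := m) (n := n) (φ := φ) (ψ := ψ) i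
  exact hM.of_coprime hN (hM' N fun k hk ↦ hN' _ fun l hl ↦ h k l (hk.trans hl))

theorem killsPow_annulusMap (h : ∀ i j : Fin (s + 1), i ≤ j → Nat.gcd (m i) (n j) = 1)
    (k : Fin s) : KillsPow (annulusMap m n φ ψ k) 1 := by
  refine ((killsPow_endMap_annulusMap_zero (killsPow_coreMap h k.castSucc)).comp
    -- Multiplying the second coordinate by the time retracts the annulus to its end `0`.
    ContinuousMap.fst).of_homotopic ⟨⟨⟨fun x ↦ annulusMap m n φ ψ k (x.2.1, x.1 * x.2.2), ?_⟩,
      fun x ↦ ?_, fun x ↦ ?_⟩⟩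
  · exact (annulusMap m n φ ψ k).continuous.comp (by fun_prop)
  · simp [endMap]
  · simp

section Embedding

/-- Testing against a Hausdorff target spares a proof that the stratifold is Hausdorff. -/
theorem isEmbedding_of_comp_injective {K X Z : Type*} [TopologicalSpace K] [TopologicalSpace X]
    [TopologicalSpace Z] [CompactSpace K] [T2Space Z] (f : C(K, X)) (r : C(X, Z))
    (h : Function.Injective (r ∘ f)) : IsEmbedding f :=
  .of_comp f.continuous r.continuous
    ((r.continuous.comp f.continuous).isClosedEmbedding h).isEmbedding

/-- The test map is the identity on `C_i`, shrinks to `0` along its sheets, and is `0` elsewhere. -/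
theorem isEmbedding_coreMap (i : Fin (s + 1)) : IsEmbedding (coreMap m n φ ψ i) := by
  classical
  let cut (k : ℕ) (j : Fin (s + 1)) : C(Circle × I, ℂ) := if j = i then
    ⟨fun x ↦ ((1 - x.2 : ℝ) : ℂ) * (x.1 ^ k : Circle), by fun_prop⟩ else 0
  let c (j : Fin (s + 1)) : C(Circle, ℂ) := if j = i then ⟨fun z ↦ (z : ℂ), by fun_prop⟩ else 0
  have hcut (k : ℕ) (j : Fin (s + 1)) (z : Circle) : cut k j (z, 0) = c j (z ^ k) := by
    by_cases hj : j = i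
    · simp only [cut, c, if_pos hj]
      change ((1 - (0 : ℝ) : ℝ) : ℂ) * (z ^ k : Circle) = (z ^ k : Circle)
      simp
    · simp only [cut, c, if_neg hj]
      rfl
  have hcut' (k : ℕ) (j : Fin (s + 1)) (z : Circle) : cut k j (z, 1) = 0 := by
    simp only [cut]
    split_ifs <;> simp
  have h : Compatible (m := m) (n := n) (φ := φ) (ψ := ψ) c (fun j ↦ cut (m j) j)
      (fun j ↦ cut (n j) j) 0 0 0 :=
    ⟨fun _ _ ↦ hcut _ _ _, fun _ _ ↦ hcut _ _ _, fun _ ↦ hcut' _ _ _, fun _ ↦ hcut' _ _ _,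
      fun _ _ ↦ hcut' _ _ _, fun _ _ ↦ hcut' _ _ _⟩
  refine isEmbedding_of_comp_injective _ (lift h) fun z w hzw ↦ Circle.ext ?_
  have hzw' : c i z = c i w := hzw
  simp only [c, if_true] at hzw'
  exact hzw'

/-- The cone on a homeomorphism of the circle, scaled by a real number. -/
noncomputable def coneMap (a : ℝ) (θ : Circle ≃ₜ Circle) : C(Circle × I, ℂ) :=
  ⟨fun x ↦ ((a * x.2 : ℝ) : ℂ) * (θ x.1 : Circle), by fun_prop⟩

@[simp] theorem coneMap_zero (a : ℝ) (θ : Circle ≃ₜ Circle) (z : Circle) :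
    coneMap a θ (z, 0) = 0 := by
  simp [coneMap]

@[simp] theorem coneMap_one (a : ℝ) (θ : Circle ≃ₜ Circle) (z : Circle) :
    coneMap a θ (z, 1) = a * (θ z : ℂ) := by
  simp [coneMap]

theorem isEmbedding_firstMap : IsEmbedding (firstMap m n φ ψ) := by
  classical
  have h : Compatible (m := m) (n := n) (φ := φ) (ψ := ψ) 0
      (fun j ↦ if j = 0 then coneMap 1 (φ 0) else 0) 0
      (⟨fun x ↦ (x : ℂ), by fun_prop⟩ : C(Disk, ℂ)) 0 0 := by
    refine ⟨fun i z ↦ ?_, fun _ _ ↦ rfl, fun z ↦ ?_, fun _ ↦ rfl, fun _ _ ↦ rfl, fun k z ↦ ?_⟩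
    · split_ifs <;> simp
    · simp [boundary]
    · simp
  exact isEmbedding_of_comp_injective _ (lift h) fun z w hzw ↦ Subtype.ext hzw

theorem isEmbedding_lastMap : IsEmbedding (lastMap m n φ ψ) := by
  classical
  have h : Compatible (m := m) (n := n) (φ := φ) (ψ := ψ) 0 0
      (fun j ↦ if j = Fin.last s then coneMap 1 (ψ (Fin.last s)) else 0) 0
      (⟨fun x ↦ (x : ℂ), by fun_prop⟩ : C(Disk, ℂ)) 0 := by
    refine ⟨fun _ _ ↦ rfl, fun i z ↦ ?_, fun _ ↦ rfl, fun z ↦ ?_, fun k z ↦ ?_, fun _ _ ↦ rfl⟩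
    · split_ifs <;> simp
    · simp [boundary]
    · simp [(Fin.castSucc_lt_last k).ne]
  exact isEmbedding_of_comp_injective _ (lift h) fun z w hzw ↦ Subtype.ext hzw

/-- The test map takes the annulus to `1 ≤ |z| ≤ 2` and cones off the adjacent sheets, with scale
`1` inside and `2` outside. -/
theorem isEmbedding_annulusMap (k : Fin s) : IsEmbedding (annulusMap m n φ ψ k) := by
  classical
  let a (j : Fin s) : C(Circle × I, ℂ) := if j = k then
    ⟨fun x ↦ ((1 + x.2 : ℝ) : ℂ) * (x.1 : Circle), by fun_prop⟩ else 0
  have h : Compatible (m := m) (n := n) (φ := φ) (ψ := ψ) 0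
      (fun j ↦ if j = k.succ then coneMap 2 (φ j) else 0)
      (fun j ↦ if j = k.castSucc then coneMap 1 (ψ j) else 0) 0 0 a := by
    refine ⟨fun i z ↦ ?_, fun i z ↦ ?_, fun z ↦ ?_, fun z ↦ ?_, fun j z ↦ ?_, fun j z ↦ ?_⟩
    · split_ifs <;> simp
    · split_ifs <;> simp
    · simp [(Fin.succ_ne_zero k).symm]
    · simp [(Fin.castSucc_lt_last k).ne']
    · by_cases hj : j = k <;> simp [a, hj]
    · by_cases hj : j = k
      · subst hj
        simp [a]
        norm_num
      · simp [a, hj]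
  refine isEmbedding_of_comp_injective _ (lift h) fun x y hxy ↦ ?_
  have hxy' : a k x = a k y := hxy
  simp only [a, if_true, ContinuousMap.coe_mk] at hxy'
  have hx := x.2.2.1
  have hy := y.2.2.1
  have h2 : (x.2 : ℝ) = y.2 := by
    have := congrArg norm hxy'
    rw [norm_mul, norm_mul, Circle.norm_coe, Circle.norm_coe, Complex.norm_real, Complex.norm_real,
      Real.norm_of_nonneg (by linarith), Real.norm_of_nonneg (by linarith)] at this
    linarith
  refine Prod.ext (Circle.ext ?_) (Subtype.ext h2)
  rw [h2] at hxy'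
  refine mul_left_cancel₀ ?_ hxy'
  exact_mod_cast (by linarith : (0 : ℝ) < 1 + y.2).ne'

end Embedding

end LinearStratifold

end

/-! ### Deformations of the stratifold and its height function. -/

section

open unitInterval Topology

namespace LinearStratifold

variable {s : ℕ} {m n : Fin (s + 1) → ℕ} {φ ψ : Fin (s + 1) → Circle ≃ₜ Circle}

section Reparametrization

/-- A homotopy of the interval relative to its end points, applied to the sheets, is a homotopy of
the stratifold. -/
theorem exists_homotopic_reparametrization (κ : C(I × I, I)) (h0 : ∀ t, κ (0, t) = 0)
    (h1 : ∀ t, κ (1, t) = 1) (hid : ∀ u, κ (u, 0) = u) :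
    ∃ h : C(LinearStratifold m n φ ψ, LinearStratifold m n φ ψ),
      (ContinuousMap.id _).Homotopic h ∧
      (∀ i z, h (coreMap m n φ ψ i z) = coreMap m n φ ψ i z) ∧
      (∀ i z u, h (sheetLMap m n φ ψ i (z, u)) = sheetLMap m n φ ψ i (z, κ (u, 1))) ∧
      (∀ i z u, h (sheetRMap m n φ ψ i (z, u)) = sheetRMap m n φ ψ i (z, κ (u, 1))) ∧
      (∀ x, h (firstMap m n φ ψ x) = firstMap m n φ ψ x) ∧
      (∀ x, h (lastMap m n φ ψ x) = lastMap m n φ ψ x) ∧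
      ∀ k x, h (annulusMap m n φ ψ k x) = annulusMap m n φ ψ k x := by
  let K : C((Circle × I) × I, Circle × I) := ⟨fun p ↦ (p.1.1, κ (p.1.2, p.2)), by fun_prop⟩
  -- The homotopy is built as a map into the space of paths, so only the quotient itself has to be
  -- mapped out of, not its product with `I`.
  have hc : Compatible (m := m) (n := n) (φ := φ) (ψ := ψ)
      (fun i ↦ ((coreMap m n φ ψ i).comp ContinuousMap.fst).curry)
      (fun i ↦ ((sheetLMap m n φ ψ i).comp K).curry)
      (fun i ↦ ((sheetRMap m n φ ψ i).comp K).curry)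
      ((firstMap m n φ ψ).comp ContinuousMap.fst).curry
      ((lastMap m n φ ψ).comp ContinuousMap.fst).curry
      (fun k ↦ ((annulusMap m n φ ψ k).comp ContinuousMap.fst).curry) := by
    refine ⟨fun i z ↦ ?_, fun i z ↦ ?_, fun z ↦ ?_, fun z ↦ ?_, fun k z ↦ ?_, fun k z ↦ ?_⟩ <;>
      ext t <;>
      simp only [ContinuousMap.curry_apply, ContinuousMap.comp_apply, ContinuousMap.fst_apply, K,
        ContinuousMap.coe_mk, h0, h1]
    exacts [sheetLMap_zero i z, sheetRMap_zero i z, sheetLMap_first z, sheetRMap_last z,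
      sheetRMap_castSucc k z, sheetLMap_succ k z]
  let G := (lift hc).uncurry
  refine ⟨G.comp ⟨fun x ↦ (x, 1), by fun_prop⟩,
    ⟨⟨G.comp ContinuousMap.prodSwap, fun x ↦ ?_, fun x ↦ rfl⟩⟩, fun _ _ ↦ rfl, fun _ _ _ ↦ rfl,
    fun _ _ _ ↦ rfl, fun _ ↦ rfl, fun _ ↦ rfl, fun _ _ ↦ rfl⟩
  change lift hc x 0 = x
  refine ind (P := fun x ↦ lift hc x 0 = x) (fun _ _ ↦ rfl) (fun i x ↦ ?_) (fun i x ↦ ?_)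
    (fun _ ↦ rfl) (fun _ ↦ rfl) (fun _ _ ↦ rfl) x
  · change sheetLMap m n φ ψ i (x.1, κ (x.2, 0)) = _
    rw [hid]
  · change sheetRMap m n φ ψ i (x.1, κ (x.2, 0)) = _
    rw [hid]

/-- A homotopy of the interval that pushes an initial segment to the initial point. -/
noncomputable def pushZero : C(I × I, I) :=
  -- At time `1` this is `4u - 3` clipped to `[0, 1]`, zero for `u ≤ 3/4`; in `pushOne` it is `4u`,
  -- which clips to one for `u ≥ 1/4`.
  ⟨fun x ↦ Set.projIcc 0 1 zero_le_one ((1 + 3 * x.2) * x.1 - 3 * x.2 : ℝ),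
    continuous_projIcc.comp (by fun_prop)⟩

/-- A homotopy of the interval that pushes a terminal segment to the terminal point. -/
noncomputable def pushOne : C(I × I, I) :=
  ⟨fun x ↦ Set.projIcc 0 1 zero_le_one ((1 + 3 * x.2) * x.1 : ℝ),
    continuous_projIcc.comp (by fun_prop)⟩

/-- The stratifold can be pushed into the circles near them. -/
theorem exists_homotopic_pushZero : ∃ h : C(LinearStratifold m n φ ψ, LinearStratifold m n φ ψ),
    (ContinuousMap.id _).Homotopic h ∧
      (∀ i z, h (coreMap m n φ ψ i z) = coreMap m n φ ψ i z) ∧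
      (∀ i z (u : I), (u : ℝ) < 3 / 4 →
        h (sheetLMap m n φ ψ i (z, u)) = coreMap m n φ ψ i (z ^ m i)) ∧
      ∀ i z (u : I), (u : ℝ) < 3 / 4 →
        h (sheetRMap m n φ ψ i (z, u)) = coreMap m n φ ψ i (z ^ n i) := by
  obtain ⟨h, hid, hc, hl, hr, -⟩ := exists_homotopic_reparametrization (m := m) (n := n) (φ := φ)
    (ψ := ψ) pushZero (fun t ↦ Set.projIcc_of_le_left zero_le_one (by simpa using t.2.1))
    (fun t ↦ Set.projIcc_of_right_le zero_le_one (by simp))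
    fun u ↦ (congrArg (Set.projIcc 0 1 zero_le_one)
      (by simp : (1 + 3 * ((0 : I) : ℝ)) * (u : ℝ) - 3 * ((0 : I) : ℝ) = u)).trans
        (Set.projIcc_val zero_le_one u)
  have key (u : I) (hu : (u : ℝ) < 3 / 4) : pushZero (u, 1) = 0 :=
    Set.projIcc_of_le_left zero_le_one (by simp only [Set.Icc.coe_one]; linarith)
  refine ⟨h, hid, hc, fun i z u hu ↦ ?_, fun i z u hu ↦ ?_⟩
  · rw [hl, key u hu, sheetLMap_zero]
  · rw [hr, key u hu, sheetRMap_zero]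

/-- The stratifold can be pushed into the disks and annuli near them. -/
theorem exists_homotopic_pushOne : ∃ h : C(LinearStratifold m n φ ψ, LinearStratifold m n φ ψ),
    (ContinuousMap.id _).Homotopic h ∧
      (∀ i z (u : I), 1 / 4 < (u : ℝ) →
        h (sheetLMap m n φ ψ i (z, u)) = sheetLMap m n φ ψ i (z, 1)) ∧
      (∀ i z (u : I), 1 / 4 < (u : ℝ) →
        h (sheetRMap m n φ ψ i (z, u)) = sheetRMap m n φ ψ i (z, 1)) ∧
      (∀ x, h (firstMap m n φ ψ x) = firstMap m n φ ψ x) ∧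
      (∀ x, h (lastMap m n φ ψ x) = lastMap m n φ ψ x) ∧
      ∀ k x, h (annulusMap m n φ ψ k x) = annulusMap m n φ ψ k x := by
  obtain ⟨h, hid, -, hl, hr, hw⟩ := exists_homotopic_reparametrization (m := m) (n := n) (φ := φ)
    (ψ := ψ) pushOne (fun t ↦ Set.projIcc_of_le_left zero_le_one (by simp))
    (fun t ↦ Set.projIcc_of_right_le zero_le_one (by simpa using t.2.1))
    fun u ↦ (congrArg (Set.projIcc 0 1 zero_le_one)
      (by simp : (1 + 3 * ((0 : I) : ℝ)) * (u : ℝ) = u)).trans (Set.projIcc_val zero_le_one u)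
  have key (u : I) (hu : 1 / 4 < (u : ℝ)) : pushOne (u, 1) = 1 :=
    Set.projIcc_of_right_le zero_le_one (by simp only [Set.Icc.coe_one]; linarith)
  refine ⟨h, hid, fun i z u hu ↦ ?_, fun i z u hu ↦ ?_, hw⟩
  · rw [hl, key u hu]
  · rw [hr, key u hu]

end Reparametrization

section Height

/-- `C_i` lies at `3i`, its sheets fill `[3i - 1, 3i]` and `[3i, 3i + 1]`, the annulus `k` fills
`[3k + 1, 3k + 2]`, and the disks fill `[-2, -1]` and `[3s + 1, 3s + 2]`. -/
theorem compatible_height : Compatible (m := m) (n := n) (φ := φ) (ψ := ψ) (Z := ℝ)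
    (fun i ↦ .const _ (3 * (i : ℕ) : ℝ))
    (fun i ↦ ⟨fun x ↦ 3 * (i : ℕ) - (x.2 : ℝ), by fun_prop⟩)
    (fun i ↦ ⟨fun x ↦ 3 * (i : ℕ) + (x.2 : ℝ), by fun_prop⟩)
    ⟨fun x ↦ -2 + ‖(x : ℂ)‖, by fun_prop⟩ ⟨fun x ↦ 3 * s + 2 - ‖(x : ℂ)‖, by fun_prop⟩
    (fun k ↦ ⟨fun x ↦ 3 * (k : ℕ) + 1 + (x.2 : ℝ), by fun_prop⟩) := by
  refine ⟨fun i z ↦ ?_, fun i z ↦ ?_, fun z ↦ ?_, fun z ↦ ?_, fun k z ↦ ?_, fun k z ↦ ?_⟩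
  · simp
  · simp
  · have := Circle.norm_coe (φ 0 z)
    simp [boundary, this]
    norm_num
  · have := Circle.norm_coe (ψ (Fin.last s) z)
    simp [boundary, this]
    ring
  · simp
  · simp; ring

/-- A height function on the stratifold: the pieces follow one another along the real line. -/
noncomputable def height : C(LinearStratifold m n φ ψ, ℝ) := lift compatible_height

theorem height_coreMap (i : Fin (s + 1)) (z : Circle) :
    height (coreMap m n φ ψ i z) = 3 * (i : ℕ) := rfl

theorem height_sheetLMap (i : Fin (s + 1)) (x : Circle × I) :
    height (sheetLMap m n φ ψ i x) = 3 * (i : ℕ) - x.2 := rfl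

theorem height_sheetRMap (i : Fin (s + 1)) (x : Circle × I) :
    height (sheetRMap m n φ ψ i x) = 3 * (i : ℕ) + x.2 := rfl

theorem height_firstMap_mem (x : Disk) : height (firstMap m n φ ψ x) ∈ Set.Icc (-2 : ℝ) (-1) := by
  have h : ‖(x : ℂ)‖ ≤ 1 := mem_closedBall_zero_iff.1 x.2
  have h' := norm_nonneg (x : ℂ)
  have : height (firstMap m n φ ψ x) = -2 + ‖(x : ℂ)‖ := rfl
  constructor <;> linarith

theorem height_lastMap_mem (x : Disk) :
    height (lastMap m n φ ψ x) ∈ Set.Icc (3 * s + 1 : ℝ) (3 * s + 2) := by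
  have h : ‖(x : ℂ)‖ ≤ 1 := mem_closedBall_zero_iff.1 x.2
  have h' := norm_nonneg (x : ℂ)
  have : height (lastMap m n φ ψ x) = 3 * s + 2 - ‖(x : ℂ)‖ := rfl
  constructor <;> linarith

theorem height_annulusMap_mem (k : Fin s) (x : Circle × I) :
    height (annulusMap m n φ ψ k x) ∈ Set.Icc (3 * (k : ℕ) + 1 : ℝ) (3 * (k : ℕ) + 2) := by
  have h := x.2.2.1
  have h' := x.2.2.2
  have : height (annulusMap m n φ ψ k x) = 3 * (k : ℕ) + 1 + (x.2 : ℝ) := rfl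
  constructor <;> linarith

theorem isOpen_height_preimage {J : Set ℝ} (hJ : IsOpen J) :
    IsOpen (height (m := m) (n := n) (φ := φ) (ψ := ψ) ⁻¹' J) := hJ.preimage height.continuous

end Height

end LinearStratifold

end

/-! ### Slabs of the height function and simple connectedness. -/

section

open unitInterval Topology

namespace LinearStratifold

variable {s : ℕ} {m n : Fin (s + 1) → ℕ} {φ ψ : Fin (s + 1) → Circle ≃ₜ Circle}

/-- The gap of one is stated over `ℝ` so that `linarith` can separate pieces with different indices.
-/
theorem nat_trichotomy (a b : ℕ) : (a : ℝ) + 1 ≤ b ∨ a = b ∨ (b : ℝ) + 1 ≤ a := by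
  rcases lt_trichotomy a b with h | h | h
  · exact Or.inl (by exact_mod_cast h)
  · exact Or.inr (Or.inl h)
  · exact Or.inr (Or.inr (by exact_mod_cast h))

section Slabs

/-- A neighbourhood of a circle `C_i`. -/
theorem height_preimage_core (i : Fin (s + 1)) :
    height (m := m) (n := n) (φ := φ) (ψ := ψ) ⁻¹'
      Set.Ioo (3 * (i : ℕ) - 3 / 4 : ℝ) (3 * (i : ℕ) + 3 / 4) =
    Set.range (coreMap m n φ ψ i) ∪ sheetLMap m n φ ψ i '' {x | (x.2 : ℝ) ∈ Set.Iio (3 / 4)} ∪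
      sheetRMap m n φ ψ i '' {x | (x.2 : ℝ) ∈ Set.Iio (3 / 4)} := by
  have hi : ((i : ℕ) : ℝ) ≤ s := by exact_mod_cast i.is_le
  have hi0 : (0 : ℝ) ≤ (i : ℕ) := Nat.cast_nonneg _
  refine Set.Subset.antisymm (fun x hx ↦ ?_) ?_
  · revert hx
    refine ind (P := fun x ↦ height x ∈ Set.Ioo _ _ → x ∈ _) (fun j z ⟨h1, h2⟩ ↦ ?_)
      (fun j x ⟨h1, h2⟩ ↦ ?_) (fun j x ⟨h1, h2⟩ ↦ ?_) (fun x ⟨h1, h2⟩ ↦ ?_)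
      (fun x ⟨h1, h2⟩ ↦ ?_) (fun j x ⟨h1, h2⟩ ↦ ?_) x
    · rw [height_coreMap] at h1 h2
      rcases nat_trichotomy j i with h | h | h
      · exfalso; linarith
      · obtain rfl := Fin.ext h
        exact Or.inl (Or.inl ⟨z, rfl⟩)
      · exfalso; linarith
    · rw [height_sheetLMap] at h1 h2
      have := x.2.2.1
      have := x.2.2.2
      rcases nat_trichotomy j i with h | h | h
      · exfalso; linarith
      · obtain rfl := Fin.ext h
        exact Or.inl (Or.inr ⟨x, show (x.2 : ℝ) < 3 / 4 by linarith, rfl⟩)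
      · exfalso; linarith
    · rw [height_sheetRMap] at h1 h2
      have := x.2.2.1
      have := x.2.2.2
      rcases nat_trichotomy j i with h | h | h
      · exfalso; linarith
      · obtain rfl := Fin.ext h
        exact Or.inr ⟨x, show (x.2 : ℝ) < 3 / 4 by linarith, rfl⟩
      · exfalso; linarith
    · have := (height_firstMap_mem (m := m) (n := n) (φ := φ) (ψ := ψ) x).2
      linarith
    · have := (height_lastMap_mem (m := m) (n := n) (φ := φ) (ψ := ψ) x).1
      linarith
    · have := height_annulusMap_mem (m := m) (n := n) (φ := φ) (ψ := ψ) j x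
      rcases nat_trichotomy j i with h | h | h
      · linarith [this.2]
      · rw [h] at this
        linarith [this.1]
      · linarith [this.1]
  · rintro _ ((⟨z, rfl⟩ | ⟨x, hx, rfl⟩) | ⟨x, hx, rfl⟩)
    · rw [Set.mem_preimage, height_coreMap]
      constructor <;> linarith
    · have hx' : (x.2 : ℝ) < 3 / 4 := hx
      have := x.2.2.1
      rw [Set.mem_preimage, height_sheetLMap]
      constructor <;> linarith
    · have hx' : (x.2 : ℝ) < 3 / 4 := hx
      have := x.2.2.1
      rw [Set.mem_preimage, height_sheetRMap]
      constructor <;> linarith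

/-- The middle part of a cylinder on the left of a circle `C_i`. -/
theorem height_preimage_sheetL (i : Fin (s + 1)) :
    height (m := m) (n := n) (φ := φ) (ψ := ψ) ⁻¹'
      Set.Ioo (3 * (i : ℕ) - 3 / 4 : ℝ) (3 * (i : ℕ) - 1 / 4) =
    sheetLMap m n φ ψ i '' {x | (x.2 : ℝ) ∈ Set.Ioo (1 / 4) (3 / 4)} := by
  refine Set.Subset.antisymm (fun x ⟨h1, h2⟩ ↦ ?_) ?_
  · have hx : x ∈ height (m := m) (n := n) (φ := φ) (ψ := ψ) ⁻¹'
        Set.Ioo (3 * (i : ℕ) - 3 / 4 : ℝ) (3 * (i : ℕ) + 3 / 4) := ⟨h1, by linarith⟩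
    rw [height_preimage_core] at hx
    rcases hx with (⟨z, rfl⟩ | ⟨x, hx, rfl⟩) | ⟨x, hx, rfl⟩
    · rw [height_coreMap] at h2
      linarith
    · rw [height_sheetLMap] at h2
      exact ⟨x, ⟨by linarith, hx⟩, rfl⟩
    · rw [height_sheetRMap] at h2
      linarith [x.2.2.1]
  · rintro _ ⟨x, ⟨hx, hx'⟩, rfl⟩
    rw [Set.mem_preimage, height_sheetLMap]
    constructor <;> linarith

/-- The middle part of a cylinder on the right of a circle `C_i`. -/
theorem height_preimage_sheetR (i : Fin (s + 1)) :
    height (m := m) (n := n) (φ := φ) (ψ := ψ) ⁻¹'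
      Set.Ioo (3 * (i : ℕ) + 1 / 4 : ℝ) (3 * (i : ℕ) + 3 / 4) =
    sheetRMap m n φ ψ i '' {x | (x.2 : ℝ) ∈ Set.Ioo (1 / 4) (3 / 4)} := by
  refine Set.Subset.antisymm (fun x ⟨h1, h2⟩ ↦ ?_) ?_
  · have hx : x ∈ height (m := m) (n := n) (φ := φ) (ψ := ψ) ⁻¹'
        Set.Ioo (3 * (i : ℕ) - 3 / 4 : ℝ) (3 * (i : ℕ) + 3 / 4) := ⟨by linarith, h2⟩
    rw [height_preimage_core] at hx
    rcases hx with (⟨z, rfl⟩ | ⟨x, hx, rfl⟩) | ⟨x, hx, rfl⟩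
    · rw [height_coreMap] at h1
      linarith
    · rw [height_sheetLMap] at h1
      linarith [x.2.2.1]
    · rw [height_sheetRMap] at h1
      exact ⟨x, ⟨by linarith, hx⟩, rfl⟩
  · rintro _ ⟨x, ⟨hx, hx'⟩, rfl⟩
    rw [Set.mem_preimage, height_sheetRMap]
    constructor <;> linarith

/-- A neighbourhood of an annulus. -/
theorem height_preimage_annulus (k : Fin s) :
    height (m := m) (n := n) (φ := φ) (ψ := ψ) ⁻¹'
      Set.Ioo (3 * (k : ℕ) + 1 / 4 : ℝ) (3 * (k : ℕ) + 11 / 4) =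
    Set.range (annulusMap m n φ ψ k) ∪
      sheetRMap m n φ ψ k.castSucc '' {x | (x.2 : ℝ) ∈ Set.Ioi (1 / 4)} ∪
      sheetLMap m n φ ψ k.succ '' {x | (x.2 : ℝ) ∈ Set.Ioi (1 / 4)} := by
  have hk : ((k : ℕ) : ℝ) + 1 ≤ s := by exact_mod_cast k.is_lt
  have hk0 : (0 : ℝ) ≤ (k : ℕ) := Nat.cast_nonneg _
  refine Set.Subset.antisymm (fun x hx ↦ ?_) ?_
  · revert hx
    refine ind (P := fun x ↦ height x ∈ Set.Ioo _ _ → x ∈ _) (fun j z ⟨h1, h2⟩ ↦ ?_)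
      (fun j x ⟨h1, h2⟩ ↦ ?_) (fun j x ⟨h1, h2⟩ ↦ ?_) (fun x ⟨h1, h2⟩ ↦ ?_)
      (fun x ⟨h1, h2⟩ ↦ ?_) (fun j x ⟨h1, h2⟩ ↦ ?_) x
    · rw [height_coreMap] at h1 h2
      rcases nat_trichotomy j k with h | h | h
      · exfalso; linarith
      · rw [h] at h1
        exfalso; linarith
      · exfalso; linarith
    · rw [height_sheetLMap] at h1 h2
      have := x.2.2.1
      have := x.2.2.2
      rcases nat_trichotomy j (k + 1) with h | h | h
      · push_cast at h
        exfalso; linarith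
      · obtain rfl : j = k.succ := Fin.ext h
        rw [Fin.val_succ] at h2
        push_cast at h2
        exact Or.inr ⟨x, show 1 / 4 < (x.2 : ℝ) by linarith, rfl⟩
      · push_cast at h
        exfalso; linarith
    · rw [height_sheetRMap] at h1 h2
      have := x.2.2.1
      have := x.2.2.2
      rcases nat_trichotomy j k with h | h | h
      · exfalso; linarith
      · obtain rfl : j = k.castSucc := Fin.ext h
        rw [Fin.val_castSucc] at h1
        exact Or.inl (Or.inr ⟨x, show 1 / 4 < (x.2 : ℝ) by linarith, rfl⟩)
      · exfalso; linarith
    · have := (height_firstMap_mem (m := m) (n := n) (φ := φ) (ψ := ψ) x).2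
      exfalso; linarith
    · have := (height_lastMap_mem (m := m) (n := n) (φ := φ) (ψ := ψ) x).1
      exfalso; linarith
    · have := height_annulusMap_mem (m := m) (n := n) (φ := φ) (ψ := ψ) j x
      rcases nat_trichotomy j k with h | h | h
      · exfalso; linarith [this.2]
      · obtain rfl := Fin.ext h
        exact Or.inl (Or.inl ⟨x, rfl⟩)
      · exfalso; linarith [this.1]
  · rintro _ ((⟨x, rfl⟩ | ⟨x, hx, rfl⟩) | ⟨x, hx, rfl⟩)
    · have := height_annulusMap_mem (m := m) (n := n) (φ := φ) (ψ := ψ) k x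
      exact ⟨by linarith [this.1], by linarith [this.2]⟩
    · have hx' : 1 / 4 < (x.2 : ℝ) := hx
      have := x.2.2.2
      rw [Set.mem_preimage, height_sheetRMap, Fin.val_castSucc]
      constructor <;> linarith
    · have hx' : 1 / 4 < (x.2 : ℝ) := hx
      have := x.2.2.2
      rw [Set.mem_preimage, height_sheetLMap, Fin.val_succ]
      push_cast
      constructor <;> linarith

/-- A neighbourhood of the first disk. -/
theorem height_preimage_first :
    height (m := m) (n := n) (φ := φ) (ψ := ψ) ⁻¹' Set.Iio (-1 / 4 : ℝ) =
    Set.range (firstMap m n φ ψ) ∪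
      sheetLMap m n φ ψ 0 '' {x | (x.2 : ℝ) ∈ Set.Ioi (1 / 4)} := by
  refine Set.Subset.antisymm (fun x hx ↦ ?_) ?_
  · revert hx
    refine ind (P := fun x ↦ height x < _ → x ∈ _) (fun j z h1 ↦ ?_)
      (fun j x h1 ↦ ?_) (fun j x h1 ↦ ?_) (fun x h1 ↦ ?_) (fun x h1 ↦ ?_) (fun j x h1 ↦ ?_) x
    · rw [height_coreMap] at h1
      have : (0 : ℝ) ≤ (j : ℕ) := Nat.cast_nonneg _
      exfalso; linarith
    · rw [height_sheetLMap] at h1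
      have := x.2.2.2
      rcases nat_trichotomy j 0 with h | h | h
      · have : (0 : ℝ) ≤ (j : ℕ) := Nat.cast_nonneg _
        push_cast at h
        exfalso; linarith
      · obtain rfl : j = 0 := Fin.ext h
        rw [Fin.val_zero] at h1
        push_cast at h1
        exact Or.inr ⟨x, show 1 / 4 < (x.2 : ℝ) by linarith, rfl⟩
      · push_cast at h
        exfalso; linarith
    · rw [height_sheetRMap] at h1
      have := x.2.2.1
      have : (0 : ℝ) ≤ (j : ℕ) := Nat.cast_nonneg _
      exfalso; linarith
    · exact Or.inl ⟨x, rfl⟩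
    · have := (height_lastMap_mem (m := m) (n := n) (φ := φ) (ψ := ψ) x).1
      have : (0 : ℝ) ≤ s := Nat.cast_nonneg _
      exfalso; linarith
    · have := (height_annulusMap_mem (m := m) (n := n) (φ := φ) (ψ := ψ) j x).1
      have : (0 : ℝ) ≤ (j : ℕ) := Nat.cast_nonneg _
      exfalso; linarith
  · rintro _ (⟨x, rfl⟩ | ⟨x, hx, rfl⟩)
    · have := (height_firstMap_mem (m := m) (n := n) (φ := φ) (ψ := ψ) x).2
      rw [Set.mem_preimage, Set.mem_Iio]
      linarith
    · have hx' : 1 / 4 < (x.2 : ℝ) := hx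
      rw [Set.mem_preimage, height_sheetLMap, Fin.val_zero, Set.mem_Iio]
      push_cast
      linarith

/-- A neighbourhood of the last disk. -/
theorem height_preimage_last :
    height (m := m) (n := n) (φ := φ) (ψ := ψ) ⁻¹' Set.Ioi (3 * s + 1 / 4 : ℝ) =
    Set.range (lastMap m n φ ψ) ∪
      sheetRMap m n φ ψ (Fin.last s) '' {x | (x.2 : ℝ) ∈ Set.Ioi (1 / 4)} := by
  refine Set.Subset.antisymm (fun x hx ↦ ?_) ?_
  · revert hx
    refine ind (P := fun x ↦ _ < height x → x ∈ _) (fun j z h1 ↦ ?_)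
      (fun j x h1 ↦ ?_) (fun j x h1 ↦ ?_) (fun x h1 ↦ ?_) (fun x h1 ↦ ?_) (fun j x h1 ↦ ?_) x
    · rw [height_coreMap] at h1
      have : ((j : ℕ) : ℝ) ≤ s := by exact_mod_cast j.is_le
      exfalso; linarith
    · rw [height_sheetLMap] at h1
      have := x.2.2.1
      have : ((j : ℕ) : ℝ) ≤ s := by exact_mod_cast j.is_le
      exfalso; linarith
    · rw [height_sheetRMap] at h1
      have := x.2.2.2
      have hj : ((j : ℕ) : ℝ) ≤ s := by exact_mod_cast j.is_le
      rcases nat_trichotomy j s with h | h | h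
      · exfalso; linarith
      · obtain rfl : j = Fin.last s := Fin.ext h
        rw [Fin.val_last] at h1
        exact Or.inr ⟨x, show 1 / 4 < (x.2 : ℝ) by linarith, rfl⟩
      · exfalso; linarith
    · have := (height_firstMap_mem (m := m) (n := n) (φ := φ) (ψ := ψ) x).2
      have : (0 : ℝ) ≤ s := Nat.cast_nonneg _
      exfalso; linarith
    · exact Or.inl ⟨x, rfl⟩
    · have := (height_annulusMap_mem (m := m) (n := n) (φ := φ) (ψ := ψ) j x).2
      have : ((j : ℕ) : ℝ) + 1 ≤ s := by exact_mod_cast j.is_lt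
      exfalso; linarith
  · rintro _ (⟨x, rfl⟩ | ⟨x, hx, rfl⟩)
    · have := (height_lastMap_mem (m := m) (n := n) (φ := φ) (ψ := ψ) x).1
      rw [Set.mem_preimage, Set.mem_Ioi]
      linarith
    · have hx' : 1 / 4 < (x.2 : ℝ) := hx
      rw [Set.mem_preimage, height_sheetRMap, Fin.val_last, Set.mem_Ioi]
      linarith

end Slabs

section PathConnected

instance : PathConnectedSpace Circle :=
  Circle.exp_surjective.pathConnectedSpace Circle.exp.continuous

theorem isPathConnected_strip {J : Set ℝ} (hJ : J.OrdConnected)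
    (hJ' : (J ∩ Set.Icc 0 1).Nonempty) :
    IsPathConnected {x : Circle × I | (x.2 : ℝ) ∈ J} := by
  have h1 : IsPathConnected (J ∩ Set.Icc 0 1) :=
    ((hJ.inter Set.ordConnected_Icc).convex.isPathConnected hJ')
  have h2 : IsPathConnected ((↑) ⁻¹' (J ∩ Set.Icc (0 : ℝ) 1) : Set I) :=
    h1.preimage_coe Set.inter_subset_right
  convert isPathConnected_univ.prod (X := Circle) h2 using 1
  ext x
  simp

instance : PathConnectedSpace (Circle × I) :=
  pathConnectedSpace_iff_univ.2
    (by simpa using isPathConnected_strip Set.ordConnected_univ ⟨0, by simp⟩)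

variable {X : Type*} [TopologicalSpace X]

theorem isPathConnected_image_Ioi (g : C(Circle × I, X)) :
    IsPathConnected (g '' {x | (x.2 : ℝ) ∈ Set.Ioi (1 / 4)}) :=
  (isPathConnected_strip Set.ordConnected_Ioi ⟨1, by norm_num⟩).image g.continuous

theorem isPathConnected_image_Iio (g : C(Circle × I, X)) :
    IsPathConnected (g '' {x | (x.2 : ℝ) ∈ Set.Iio (3 / 4)}) :=
  (isPathConnected_strip Set.ordConnected_Iio ⟨0, by norm_num⟩).image g.continuous

theorem isPathConnected_image_Ioo (g : C(Circle × I, X)) :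
    IsPathConnected (g '' {x | (x.2 : ℝ) ∈ Set.Ioo (1 / 4) (3 / 4)}) :=
  (isPathConnected_strip Set.ordConnected_Ioo ⟨1 / 2, by norm_num⟩).image g.continuous

end PathConnected

section Thin

/-- Core slabs reach out to `3/4` along the sheets and white slabs reach in to `1/4`, so neighbours
overlap in an open cylinder. `pushZero` moves the whole core slab onto its null-homotopic circle. -/
theorem isThin_core (h : ∀ i j : Fin (s + 1), i ≤ j → Nat.gcd (m i) (n j) = 1)
    (i : Fin (s + 1)) : IsThin (height (m := m) (n := n) (φ := φ) (ψ := ψ) ⁻¹'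
      Set.Ioo (3 * (i : ℕ) - 3 / 4 : ℝ) (3 * (i : ℕ) + 3 / 4)) := by
  rw [height_preimage_core]
  obtain ⟨g, hg, hc, hl, hr⟩ := exists_homotopic_pushZero (m := m) (n := n) (φ := φ) (ψ := ψ)
  refine IsThin.of_homotopy ?_ (isEmbedding_coreMap i) (killsPow_coreMap h i) hg ?_
  · refine ((isPathConnected_range (coreMap m n φ ψ i).continuous).union
      (isPathConnected_image_Iio _) ⟨_, ⟨_, rfl⟩, (1, 0), by simp, sheetLMap_zero i 1⟩).union
      (isPathConnected_image_Iio _) ⟨_, Or.inl ⟨_, rfl⟩, (1, 0), by simp, sheetRMap_zero i 1⟩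
  · rintro _ ((⟨z, rfl⟩ | ⟨x, hx, rfl⟩) | ⟨x, hx, rfl⟩)
    · exact ⟨_, (hc i z).symm⟩
    · exact ⟨_, (hl i x.1 x.2 hx).symm⟩
    · exact ⟨_, (hr i x.1 x.2 hx).symm⟩

theorem isThin_annulus (h : ∀ i j : Fin (s + 1), i ≤ j → Nat.gcd (m i) (n j) = 1)
    (k : Fin s) : IsThin (height (m := m) (n := n) (φ := φ) (ψ := ψ) ⁻¹'
      Set.Ioo (3 * (k : ℕ) + 1 / 4 : ℝ) (3 * (k : ℕ) + 11 / 4)) := by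
  rw [height_preimage_annulus]
  obtain ⟨g, hg, hl, hr, -, -, ha⟩ :=
    exists_homotopic_pushOne (m := m) (n := n) (φ := φ) (ψ := ψ)
  refine IsThin.of_homotopy ?_ (isEmbedding_annulusMap k) (killsPow_annulusMap h k) hg ?_
  · refine ((isPathConnected_range (annulusMap m n φ ψ k).continuous).union
      (isPathConnected_image_Ioi _)
        ⟨_, ⟨_, rfl⟩, (1, 1), by norm_num, sheetRMap_castSucc k 1⟩).union
      (isPathConnected_image_Ioi _)
        ⟨_, Or.inl ⟨_, rfl⟩, (1, 1), by norm_num, sheetLMap_succ k 1⟩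
  · rintro _ ((⟨x, rfl⟩ | ⟨x, hx, rfl⟩) | ⟨x, hx, rfl⟩)
    · exact ⟨_, (ha k x).symm⟩
    · exact ⟨_, ((hr _ x.1 x.2 hx).trans (sheetRMap_castSucc k _)).symm⟩
    · exact ⟨_, ((hl _ x.1 x.2 hx).trans (sheetLMap_succ k _)).symm⟩

theorem isThin_first :
    IsThin (height (m := m) (n := n) (φ := φ) (ψ := ψ) ⁻¹' Set.Iio (-1 / 4 : ℝ)) := by
  rw [height_preimage_first]
  obtain ⟨g, hg, hl, -, hd, -⟩ := exists_homotopic_pushOne (m := m) (n := n) (φ := φ) (ψ := ψ)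
  refine IsThin.of_homotopy ?_ isEmbedding_firstMap (killsPow_one_of_simplyConnectedSpace _) hg ?_
  · exact (isPathConnected_range (firstMap m n φ ψ).continuous).union
      (isPathConnected_image_Ioi _) ⟨_, ⟨_, rfl⟩, (1, 1), by norm_num, sheetLMap_first 1⟩
  · rintro _ (⟨x, rfl⟩ | ⟨x, hx, rfl⟩)
    · exact ⟨_, (hd x).symm⟩
    · exact ⟨_, ((hl _ x.1 x.2 hx).trans (sheetLMap_first _)).symm⟩

theorem isThin_last :
    IsThin (height (m := m) (n := n) (φ := φ) (ψ := ψ) ⁻¹' Set.Ioi (3 * s + 1 / 4 : ℝ)) := by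
  rw [height_preimage_last]
  obtain ⟨g, hg, -, hr, -, he, -⟩ := exists_homotopic_pushOne (m := m) (n := n) (φ := φ) (ψ := ψ)
  refine IsThin.of_homotopy ?_ isEmbedding_lastMap (killsPow_one_of_simplyConnectedSpace _) hg ?_
  · exact (isPathConnected_range (lastMap m n φ ψ).continuous).union
      (isPathConnected_image_Ioi _) ⟨_, ⟨_, rfl⟩, (1, 1), by norm_num, sheetRMap_last 1⟩
  · rintro _ (⟨x, rfl⟩ | ⟨x, hx, rfl⟩)
    · exact ⟨_, (he x).symm⟩
    · exact ⟨_, ((hr _ x.1 x.2 hx).trans (sheetRMap_last _)).symm⟩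

theorem isThin_below_add (h : ∀ i j : Fin (s + 1), i ≤ j → Nat.gcd (m i) (n j) = 1)
    (i : Fin (s + 1)) (hi : IsThin (height (m := m) (n := n) (φ := φ) (ψ := ψ) ⁻¹'
      Set.Iio (3 * (i : ℕ) - 1 / 4 : ℝ))) :
    IsThin (height (m := m) (n := n) (φ := φ) (ψ := ψ) ⁻¹' Set.Iio (3 * (i : ℕ) + 3 / 4 : ℝ)) := by
  have hu := hi.union (isThin_core h i) (isOpen_height_preimage isOpen_Iio)
    (isOpen_height_preimage isOpen_Ioo) (by
      rw [← Set.preimage_inter, Set.Iio_inter_Ioo, inf_of_le_left (by linarith),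
        height_preimage_sheetL]
      exact isPathConnected_image_Ioo _)
  rwa [← Set.preimage_union, Set.Iio_union_Ioo (by rw [min_eq_left] <;> linarith),
    max_eq_right (by linarith)] at hu

/-- Climbing by height: each step adds a core slab up to `3k + 3/4`, then an annulus slab up to `3k
+ 11/4 = 3(k + 1) - 1/4`. -/
theorem isThin_below (h : ∀ i j : Fin (s + 1), i ≤ j → Nat.gcd (m i) (n j) = 1)
    (i : Fin (s + 1)) :
    IsThin (height (m := m) (n := n) (φ := φ) (ψ := ψ) ⁻¹' Set.Iio (3 * (i : ℕ) - 1 / 4 : ℝ)) := by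
  induction i using Fin.induction with
  | zero =>
    convert isThin_first (m := m) (n := n) (φ := φ) (ψ := ψ) using 3
    simp; norm_num
  | succ k ih =>
    have hk := isThin_below_add h _ ih
    have hu := hk.union (isThin_annulus h k) (isOpen_height_preimage isOpen_Iio)
      (isOpen_height_preimage isOpen_Ioo) (by
        rw [← Set.preimage_inter, Set.Iio_inter_Ioo, Fin.val_castSucc,
          inf_of_le_left (by linarith), ← Fin.val_castSucc, height_preimage_sheetR]
        exact isPathConnected_image_Ioo _)
    rw [Fin.val_castSucc, ← Set.preimage_union, Set.Iio_union_Ioo (by rw [min_eq_left] <;> linarith),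
      max_eq_right (by linarith)] at hu
    have e : 3 * ((k.succ : ℕ) : ℝ) - 1 / 4 = 3 * (k : ℕ) + 11 / 4 := by
      rw [Fin.val_succ]
      push_cast
      ring
    rwa [e]

theorem simplyConnectedSpace (h : ∀ i j : Fin (s + 1), i ≤ j → Nat.gcd (m i) (n j) = 1) :
    SimplyConnectedSpace (LinearStratifold m n φ ψ) := by
  have hs := isThin_below_add (φ := φ) (ψ := ψ) h _ (isThin_below h (Fin.last s))
  have hu := hs.union isThin_last (isOpen_height_preimage isOpen_Iio)
    (isOpen_height_preimage isOpen_Ioi) (by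
      have := height_preimage_sheetR (m := m) (n := n) (φ := φ) (ψ := ψ) (Fin.last s)
      rw [← Set.preimage_inter, Set.inter_comm, Set.Ioi_inter_Iio]
      exact this ▸ isPathConnected_image_Ioo _)
  rw [← Set.preimage_union, Fin.val_last, Set.Iio_union_Ioi_of_lt (by linarith),
    Set.preimage_univ] at hu
  exact hu.simplyConnectedSpace

end Thin

end LinearStratifold

end

theorem mainTheorem1 (s : ℕ) (m n : Fin (s + 1) → ℕ) (hm : ∀ i, 0 < m i) (hn : ∀ i, 0 < n i)
    (φ ψ : Fin (s + 1) → Circle ≃ₜ Circle) :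
    List.TFAE
      [SimplyConnectedSpace (LinearStratifold m n φ ψ),
        CategoryTheory.Limits.IsZero (H1 (LinearStratifold m n φ ψ)),
        ∀ i j : Fin (s + 1), i ≤ j → Nat.gcd (m i) (n j) = 1] := by
  tfae_have 1 → 2 := fun _ ↦ isZero_H1_of_simplyConnectedSpace _
  tfae_have 2 → 3 := fun h i j hij ↦ LinearStratifold.gcd_eq_one_of_isZero_H1 h i j hij
  tfae_have 3 → 1 := fun h ↦ LinearStratifold.simplyConnectedSpace h
  tfae_finish
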